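/- **Setting.** Let $n\ge 1$, $d\ge 2$, $L>0$. Consider an $n$-player game in which every player has $d$ pure strategies, with utilities $\mathcal U_i$, $|\mathcal U_i|\le 1$, whose reward vectors $\nu_i(x)[\xi]=\mathbb E_{s_{-i}\sim x_{-i}}[\mathcal U_i(\xi,s_{-i})]$ satisfy $\|\nu_i(x)-\nu_i(x')\|_\infty\le L\sum_j\|x_j-x'_j\|_1$ for all mixed profiles $x,x'$. A regularizer is a closed convex function $\psi:\Delta^d\to\mathbb R\cup\{+\infty\}$ that is finite on the relative interior of $\Delta^d$. Let $D_f(z\,\|\,w)=f(z)-f(w)-f'(w;z-w)$ be the Bregman divergence (with the one-sided directional derivative, i.e. $\langle\nabla f(w),z-w\rangle$ where $f$ is differentiable). For $\alpha>0$ put $\phi(y)=-\alpha\log(\mathbf 1^\top y)+\psi(y/\mathbf 1^\top y)$ on $(0,1]\operatorname{dom}\psi$. $\psi$ is $\gamma$-locally intrinsically Lipschitz ($\gamma$-LIL), for a function $\gamma(\epsilon)$, if $|\psi(x')-\psi(x)|^2\le\gamma(\epsilon)D_\psi(x'\|x)$ for $x'=y'/\mathbf 1^\top y'$, $x=y/\mathbf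 1^\top y$ whenever $D_\phi(y'\|y)+D_\phi(y\|y')\le\epsilon$, $\epsilon>0$. Strong convexity is with respect to $\|\cdot\|_1$. **COFTRL** with parameters $\alpha,\eta$: with $u^t=\nu^t-\langle\nu^t,x^t\rangle\mathbf 1$, $u^0=0$ and $r^t=\sum_{s<t}u^s+u^{t-1}$, choose $\lambda^t\in\arg\max_{\lambda\in(0,\eta]}\{\alpha\log\lambda+\psi^*(\lambda r^t)\}$, where $\psi^*(g)=\sup_{x\in\Delta^d}\langle g,x\rangle-\psi(x)$, and play $x^t\in\arg\max_{x\in\Delta^d}\{\lambda^t\langle r^t,x\rangle-\psi(x)\}$. **Adaptive COFTRL** with a nonnegative function $R_m$ plays COFTRL until the first time $m$ at which $\sum_{s=1}^{m-1}\|\nu^{s+1}-\nu^s\|_\infty^2>L^2n^2\frac{128\eta}{\mu}\bigl(3+\frac{\alpha\log m+R_m}{\eta}\bigr)$, and from then on runs a fresh copy of Multiplicative Weight Update with learning rate $\sqrt{\log d/s}$ in its $s$-th round. Regret is $\mathrm{Reg}_i^T=\max_{x^*\in\Delta^d}\sum_{t\le T}\langle\nu_i^t,x^*-x_i^t\rangle$.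 **Theorem.** There is a universal constant $C$ such that the following holds. (A) Let $\psi:\Delta^d\to\mathbb R$ be a real-valued, $\mu$-strongly convex ($\mu>0$), $\gamma$-LIL regularizer, let $\mathcal R=\max_{\Delta^d}\psi-\min_{\Delta^d}\psi$, $\alpha\ge4\gamma(1)+\mu$ and $$0<\eta\le\bar\eta:=\min\Bigl\{\tfrac{3\gamma(1)}{80},\tfrac18,\tfrac{\mu}{32\sqrt2},\tfrac{\mu}{32\sqrt6\,Ln}\Bigr\}.$$ Then COFTRL steps exist, and: 1. If all players follow COFTRL, then for every player $i$ and every $T\ge1$, $\mathrm{Reg}_i^T\le 6+\frac{2(\alpha\log T+\mathcal R)}{\eta}$. If $\eta=\bar\eta$, this bound reads $$\mathrm{Reg}_i^T\le 6+2\,\frac{\alpha\log T+\mathcal R}{\mu}\max\Bigl\{\tfrac{80\mu}{3\gamma(1)},8\mu,32\sqrt2,32\sqrt6\,Ln\Bigr\}.$$ If moreover $\alpha=4\gamma(1)+\mu$ and $1\le\mu\le\gamma(1)$, then for all $T\ge2$, $\mathrm{Reg}_i^T\le C\max\{1,Ln\}(\gamma(1)\log T+\mathcal R)$, and $\mathrm{Reg}_i^T\le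 C\max\{1,Ln\}\,\gamma(1)\log T$ as soon as $\mathcal R\le\gamma(1)\log T$; that is, $\mathrm{Reg}_i^T=O(Ln\,\gamma(1)\log T)$ when $Ln\ge1$. 2. If all players follow adaptive COFTRL with $R_m=\mathcal R$, then all of them play COFTRL forever, so that the bounds of 1 apply. A player who follows it against arbitrary (adaptively chosen) reward vectors in $[-1,1]^d$ has $\mathrm{Reg}^T\le 8+\frac{2(\alpha\log T+\mathcal R)}{\eta}+4\sqrt{T\log d}$ for all $T\ge1$, and there is a $T_0$ that does not depend on the rewards such that $\mathrm{Reg}^T\le C\sqrt{T\log d}$ for all $T\ge T_0$. (B) The log regularizer $\psi(x)=-\sum_k\log x[k]$ is $1$-strongly convex, and there is a function $\gamma$ with $\gamma(1)=18d$ for which it is $\gamma$-LIL for every $\alpha\ge d$. COFTRL with it is lifted log-regularized OFTRL: for $\eta>0$ and every $\alpha$, the pair $\lambda=\eta\,\mathbf 1^\top y$, $x=y/\mathbf 1^\top y$ is a COFTRL step on $r$ if and only if $y$ maximizes $\eta\langle r,y\rangle+(\alpha-d)\log(\mathbf 1^\top y)+\sum_k\log y[k]$ over $(0,1]\Delta^d$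 (for $\alpha=d+1$ this is the update of LRL-OFTRL). If $\alpha\ge72d+1$ and $0<\eta\le\bar\eta$ with $\gamma(1)=18d$, $\mu=1$, then COFTRL steps exist, the first bound of 1 and all statements of 2 hold with $\mathcal R$ and $R_m$ replaced by $d\log T$ and $d\log m$, and for $\eta=\bar\eta$, $\alpha=72d+1$ and all $T\ge2$, $\mathrm{Reg}_i^T\le C\max\{1,Ln\}\,d\log T$. -/

import Mathlib

open Filter Topology

noncomputable section

namespace COFTRL

/-! ### Convex-analytic notions -/

/-- The `ℓ₁` norm of a vector. -/
def l1 {d : ℕ} (v : Fin d → ℝ) : ℝ := ∑ k, |v k|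

/-- A regularizer of the simplex `Δ^d`: a closed convex function `ψ : Δ^d → ℝ ∪ {+∞}` which is
finite on the relative interior. It is given by its effective domain `D` (the set on which it is
finite) and its real values on `D`; values outside `D` are never used. A real-valued regularizer is
the case `D = Δ^d`; the log regularizer is finite exactly on the relative interior. -/
structure IsRegularizer {d : ℕ} (D : Set (Fin d → ℝ)) (ψ : (Fin d → ℝ) → ℝ) : Prop where
  subset_simplex : D ⊆ stdSimplex ℝ (Fin d)
  interior_subset : ∀ x ∈ stdSimplex ℝ (Fin d), (∀ k, 0 < x k) → x ∈ D
  convexOn : ConvexOn ℝ D ψ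
  closed : ∀ c : ℝ, IsClosed {x | x ∈ D ∧ ψ x ≤ c}

/-- `ψ` is `μ`-strongly convex on `D` with respect to the `ℓ₁` norm. -/
def IsStronglyConvexL1 {d : ℕ} (D : Set (Fin d → ℝ)) (ψ : (Fin d → ℝ) → ℝ) (μ : ℝ) : Prop :=
  ∀ x ∈ D, ∀ y ∈ D, ∀ a b : ℝ, 0 ≤ a → 0 ≤ b → a + b = 1 →
    ψ (a • x + b • y) ≤ a * ψ x + b * ψ y - μ / 2 * (a * b) * l1 (x - y) ^ 2

/-- Bregman divergence `D_f(z ‖ w) = f z - f w - f'(w; z - w)`, where `f'(w; ·)` is the one-sided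
directional derivative (`⟨∇f(w), z - w⟩` where `f` is differentiable). It takes the value `⊤` where
that derivative is `-∞`, which happens for instance for the entropy at the boundary of the simplex.
For the functions used below the `liminf` is a limit. -/
def bregman {d : ℕ} (f : (Fin d → ℝ) → ℝ) (z w : Fin d → ℝ) : EReal :=
  ((f z - f w : ℝ) : EReal) -
    liminf (fun t : ℝ => (((f (w + t • (z - w)) - f w) / t : ℝ) : EReal)) (𝓝[>] 0)

/-- The normalisation `y ↦ y / (1ᵀ y)`. -/
def normalize {d : ℕ} (y : Fin d → ℝ) : Fin d → ℝ := (∑ k, y k)⁻¹ • y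

/-- The lifted domain `(0, 1] D`. -/
def lifted {d : ℕ} (D : Set (Fin d → ℝ)) : Set (Fin d → ℝ) :=
  {y | 0 < ∑ k, y k ∧ ∑ k, y k ≤ 1 ∧ normalize y ∈ D}

/-- The lifted regularizer `φ(y) = - α log (1ᵀ y) + ψ (y / 1ᵀ y)`. -/
def liftedReg {d : ℕ} (ψ : (Fin d → ℝ) → ℝ) (α : ℝ) (y : Fin d → ℝ) : ℝ :=
  -α * Real.log (∑ k, y k) + ψ (normalize y)

/-- `ψ` is `γ`-locally intrinsically Lipschitz (with `α` the parameter of the lifted regularizer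
`φ`): `|ψ(x') - ψ(x)|² ≤ γ(ε) D_ψ(x' ‖ x)` for `x' = y' / 1ᵀ y'`, `x = y / 1ᵀ y`, whenever
`y', y` in the lifted domain satisfy `D_φ(y' ‖ y) + D_φ(y ‖ y') ≤ ε`. -/
def IsLIL {d : ℕ} (D : Set (Fin d → ℝ)) (ψ : (Fin d → ℝ) → ℝ) (α : ℝ) (γ : ℝ → ℝ) : Prop :=
  ∀ ε : ℝ, 0 < ε → ∀ y' ∈ lifted D, ∀ y ∈ lifted D,
    bregman (liftedReg ψ α) y' y + bregman (liftedReg ψ α) y y' ≤ (ε : EReal) →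
      ((|ψ (normalize y') - ψ (normalize y)| ^ 2 : ℝ) : EReal) ≤
        (γ ε : EReal) * bregman ψ (normalize y') (normalize y)

/-- The conjugate `ψ*(g) = sup_{x ∈ D} ⟨g, x⟩ - ψ(x)`. -/
def conj {d : ℕ} (D : Set (Fin d → ℝ)) (ψ : (Fin d → ℝ) → ℝ) (g : Fin d → ℝ) : ℝ :=
  sSup ((fun x => dotProduct g x - ψ x) '' D)

/-- The range `max ψ - min ψ` of a real-valued regularizer over the simplex. -/
def regRange {d : ℕ} (ψ : (Fin d → ℝ) → ℝ) : ℝ :=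
  sSup (ψ '' stdSimplex ℝ (Fin d)) - sInf (ψ '' stdSimplex ℝ (Fin d))

/-! ### Online learning and the algorithm. Round `t = 0, 1, …` is the `(t+1)`-st round. -/

/-- External regret over the first `T` rounds. -/
def regret {d : ℕ} (ν x : ℕ → Fin d → ℝ) (T : ℕ) : ℝ :=
  sSup ((fun z => ∑ t ∈ Finset.range T, dotProduct (ν t) z) '' stdSimplex ℝ (Fin d)) -
    ∑ t ∈ Finset.range T, dotProduct (ν t) (x t)

/-- The corrected reward signal `u = ν - ⟨ν, x⟩ 1`. -/
def signal {d : ℕ} (ν x : Fin d → ℝ) : Fin d → ℝ := fun k => ν k - dotProduct ν x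

/-- The optimistic cumulated regret vector: the sum of all past signals plus the last one once
more; it is zero in the first round. -/
def optRegret {d : ℕ} (ν x : ℕ → Fin d → ℝ) : ℕ → Fin d → ℝ
  | 0 => 0
  | t + 1 => (∑ s ∈ Finset.range (t + 1), signal (ν s) (x s)) + signal (ν t) (x t)

/-- One step of COFTRL on the optimistic regret vector `r`: the learning rate `lam` maximizes
`α log λ + ψ*(λ r)` over `λ ∈ (0, η]`, and `x` maximizes `lam ⟨r, x⟩ - ψ(x)`. -/
def IsStep {d : ℕ} (D : Set (Fin d → ℝ)) (ψ : (Fin d → ℝ) → ℝ) (α η : ℝ)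
    (r : Fin d → ℝ) (lam : ℝ) (x : Fin d → ℝ) : Prop :=
  (lam ∈ Set.Ioc 0 η ∧
    IsMaxOn (fun l : ℝ => α * Real.log l + conj D ψ (l • r)) (Set.Ioc 0 η) lam) ∧
  (x ∈ D ∧ IsMaxOn (fun z => lam * dotProduct r z - ψ z) D x)

/-- In round `t` the play `x t` is a COFTRL step on the past rewards `ν` and plays. -/
def StepAt {d : ℕ} (D : Set (Fin d → ℝ)) (ψ : (Fin d → ℝ) → ℝ) (α η : ℝ)
    (ν x : ℕ → Fin d → ℝ) (t : ℕ) : Prop :=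
  ∃ lam : ℝ, IsStep D ψ α η (optRegret ν x t) lam (x t)

/-- The plays `x` follow COFTRL on the rewards `ν`. -/
def Follows {d : ℕ} (D : Set (Fin d → ℝ)) (ψ : (Fin d → ℝ) → ℝ) (α η : ℝ)
    (ν x : ℕ → Fin d → ℝ) : Prop :=
  ∀ t, StepAt D ψ α η ν x t

/-- Multiplicative Weight Update with learning rate `√(log d / (t + 1))` in round `t`. -/
def mwu {d : ℕ} (ν : ℕ → Fin d → ℝ) (t : ℕ) : Fin d → ℝ := fun k =>
  Real.exp (√(Real.log d / (t + 1)) * ∑ s ∈ Finset.range t, ν s k) /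
    ∑ j, Real.exp (√(Real.log d / (t + 1)) * ∑ s ∈ Finset.range t, ν s j)

/-- The alarm after `m ≥ 1` observed rewards: the variation
`∑ ‖ν^{s+1} - ν^s‖_∞²` exceeds `L² n² (128 η / μ) (3 + (α log m + R m) / η)`. -/
def Alarm {d : ℕ} (n : ℕ) (L μ α η : ℝ) (R : ℕ → ℝ) (ν : ℕ → Fin d → ℝ) (m : ℕ) : Prop :=
  1 ≤ m ∧ L ^ 2 * (n : ℝ) ^ 2 * (128 * η / μ) * (3 + (α * Real.log m + R m) / η) <
    ∑ s ∈ Finset.range (m - 1), ‖ν (s + 1) - ν s‖ ^ 2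

/-- The plays `x` follow the adaptive version of COFTRL on the rewards `ν`: COFTRL is played as long
as there was no alarm, and from the first alarm on a fresh copy of Multiplicative Weight Update. -/
def FollowsAdaptive {d : ℕ} (D : Set (Fin d → ℝ)) (ψ : (Fin d → ℝ) → ℝ) (n : ℕ) (L μ α η : ℝ)
    (R : ℕ → ℝ) (ν x : ℕ → Fin d → ℝ) : Prop :=
  ∀ t, ((∀ m ≤ t, ¬ Alarm n L μ α η R ν m) → StepAt D ψ α η ν x t) ∧
    (∀ m ≤ t, IsLeast {m | Alarm n L μ α η R ν m} m →
      x t = mwu (fun s => ν (m + s)) (t - m))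

/-! ### Games -/

/-- The reward vector `∇_{x_i} ν_i(x)`: its entry `ξ` is the expectation of `U_i(ξ, s_{-i})` for
`s_{-i}` drawn from `x_{-i}`. -/
def reward {n d : ℕ} (U : Fin n → (Fin n → Fin d) → ℝ) (i : Fin n) (x : Fin n → Fin d → ℝ) :
    Fin d → ℝ := fun ξ =>
  ∑ s : Fin n → Fin d, if s i = ξ then (∏ j ∈ Finset.univ.erase i, x j (s j)) * U i s else 0

/-- Utilities are bounded by one and `L`-smooth. -/
structure IsBoundedSmooth {n d : ℕ} (L : ℝ) (U : Fin n → (Fin n → Fin d) → ℝ) : Prop where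
  bounded : ∀ i s, |U i s| ≤ 1
  smooth : ∀ i, ∀ x x' : Fin n → Fin d → ℝ, (∀ j, x j ∈ stdSimplex ℝ (Fin d)) →
    (∀ j, x' j ∈ stdSimplex ℝ (Fin d)) →
    ‖reward U i x - reward U i x'‖ ≤ L * ∑ j, l1 (x j - x' j)

/-- In the repeated game every player follows COFTRL; `x t i` is the strategy of player `i` in
round `t`. -/
def SelfPlay {n d : ℕ} (D : Set (Fin d → ℝ)) (ψ : (Fin d → ℝ) → ℝ) (α η : ℝ)
    (U : Fin n → (Fin n → Fin d) → ℝ) (x : ℕ → Fin n → Fin d → ℝ) : Prop :=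
  ∀ i, Follows D ψ α η (fun t => reward U i (x t)) (fun t => x t i)

/-- In the repeated game every player follows the adaptive version of COFTRL. -/
def SelfPlayAdaptive {n d : ℕ} (D : Set (Fin d → ℝ)) (ψ : (Fin d → ℝ) → ℝ) (L μ α η : ℝ)
    (R : ℕ → ℝ) (U : Fin n → (Fin n → Fin d) → ℝ) (x : ℕ → Fin n → Fin d → ℝ) : Prop :=
  ∀ i, FollowsAdaptive D ψ n L μ α η R (fun t => reward U i (x t)) (fun t => x t i)

/-- In every `n`-player game with bounded, `L`-smooth utilities in which all players follow COFTRL,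
the regret of every player over `T` rounds is at most `B`. -/
def SelfPlayRegretLE {d : ℕ} (D : Set (Fin d → ℝ)) (ψ : (Fin d → ℝ) → ℝ) (n : ℕ) (L α η : ℝ)
    (T : ℕ) (B : ℝ) : Prop :=
  ∀ U : Fin n → (Fin n → Fin d) → ℝ, IsBoundedSmooth L U →
    ∀ x : ℕ → Fin n → Fin d → ℝ, SelfPlay D ψ α η U x →
      ∀ i, regret (fun t => reward U i (x t)) (fun t => x t i) T ≤ B

/-- In every game with bounded, `L`-smooth utilities, if all `n` players follow the adaptive version
then all of them play COFTRL forever. -/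
def AdaptiveIsCOFTRL {d : ℕ} (D : Set (Fin d → ℝ)) (ψ : (Fin d → ℝ) → ℝ) (n : ℕ) (L μ α η : ℝ)
    (R : ℕ → ℝ) : Prop :=
  ∀ U : Fin n → (Fin n → Fin d) → ℝ, IsBoundedSmooth L U →
    ∀ x : ℕ → Fin n → Fin d → ℝ, SelfPlayAdaptive D ψ L μ α η R U x → SelfPlay D ψ α η U x

/-- The adaptive version has regret at most `B` after `T` rounds against arbitrary rewards with
entries in `[-1, 1]`. -/
def AdversarialRegretLE {d : ℕ} (D : Set (Fin d → ℝ)) (ψ : (Fin d → ℝ) → ℝ) (n : ℕ)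
    (L μ α η : ℝ) (R : ℕ → ℝ) (T : ℕ) (B : ℝ) : Prop :=
  ∀ ν x : ℕ → Fin d → ℝ, (∀ t k, |ν t k| ≤ 1) → FollowsAdaptive D ψ n L μ α η R ν x →
    regret ν x T ≤ B

/-- The cap `min {3g/80, 1/8, μ/(32√2), μ/(32√6 L n)}` on the learning rate. -/
def rateCap (g μ L : ℝ) (n : ℕ) : ℝ :=
  min (min (3 * g / 80) (1 / 8)) (min (μ / (32 * √2)) (μ / (32 * √6 * L * n)))

/-! ### The log regularizer -/

/-- The relative interior of the simplex. -/
def openSimplex (d : ℕ) : Set (Fin d → ℝ) := {x | x ∈ stdSimplex ℝ (Fin d) ∧ ∀ k, 0 < x k}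

/-- The log regularizer `- ∑ log x[k]`. -/
def logReg {d : ℕ} (x : Fin d → ℝ) : ℝ := -∑ k, Real.log (x k)

/-- A step of lifted log-regularized OFTRL: `y` maximizes
`η ⟨r, y⟩ + (α - d) log (1ᵀ y) + ∑ log y[k]` over the positive vectors of mass at most one. For
`α = d + 1` this is the update of LRL-OFTRL. -/
def IsLiftedLogStep {d : ℕ} (α η : ℝ) (r y : Fin d → ℝ) : Prop :=
  ((∀ k, 0 < y k) ∧ ∑ k, y k ≤ 1) ∧
  ∀ z : Fin d → ℝ, (∀ k, 0 < z k) → ∑ k, z k ≤ 1 →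
    η * dotProduct r z + (α - d) * Real.log (∑ k, z k) + ∑ k, Real.log (z k) ≤
      η * dotProduct r y + (α - d) * Real.log (∑ k, y k) + ∑ k, Real.log (y k)

end COFTRL

end

namespace COFTRL
variable {d : ℕ}

/-! ### The `ℓ₁` norm and the simplex -/

/-! A COFTRL step is a joint maximizer of `α log λ + λ⟨r, x⟩ - ψ x` over learning rates and
strategies (`isStep_iff`). In the coordinate `y = (λ/η) x` it is optimistic
follow-the-regularized-leader on the lifted domain, with the lifted regularizer. If the regret
vectors of two steps differ by at most 4 in sup norm, their two optimality gaps add up to a bilinear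
expression of size at most `8η ≤ 1`. The gaps dominate the Bregman divergences of the lifted
regularizer, so the LIL condition applies at `ε = 1` and controls the change of `ψ` by `D_ψ`. Since
`α ≥ 4γ(1) + μ`, the cross term between the change of `ψ` and the change of rate is absorbed
(`quadratic_gap`), and each gap is at least `μ/4` times the squared change of strategy plus the
squared relative change of rate (`IsStep.stability`).

With this stability the usual optimistic analysis (`leader_step`) telescopes to a bound of RVU type
(`regret_le_variation`): logarithmic term, plus reward variation, minus squared path length. The
signals are orthogonal to the plays, so rescaling the play earns nothing by itself. Comparing with
the small rate `η/T` shows in addition that the right side of this bound is nonnegative, whatever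
the sign of the regret.

In self-play, summing these nonnegative quantities over the players bounds the total path length,
because smoothness bounds reward variation by path length and the cap on `η` makes the negative term
win. The resulting bound on each player's reward variation is the alarm threshold
(`not_alarm_of_selfPlay`). Hence no alarm ever rings, and the absence of an alarm alone already
gives the individual regret bound (`regret_le_of_not_alarm`). Against an adversary the same bound
covers the rounds before the alarm, one round costs at most 2, and Multiplicative Weight Update
handles the rest.

For the log regularizer, divergences are sums of `u - 1 - log u`. A bounded symmetrized lifted
divergence bounds every coordinate ratio, which gives LIL with a constant linear in `d`
(`isLIL_logReg`). Its infinite range is avoided by mixing comparators with the uniform strategy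
(`exists_comparator_logReg`). -/

lemma l1_nonneg (v : Fin d → ℝ) : 0 ≤ l1 v := Finset.sum_nonneg fun _ _ => abs_nonneg _

lemma l1_add_le (v w : Fin d → ℝ) : l1 (v + w) ≤ l1 v + l1 w := by
  unfold l1
  rw [← Finset.sum_add_distrib]
  exact Finset.sum_le_sum fun k _ => abs_add_le _ _

lemma l1_smul (c : ℝ) (v : Fin d → ℝ) : l1 (c • v) = |c| * l1 v := by
  simp [l1, abs_mul, Finset.mul_sum]

lemma l1_sub_comm (v w : Fin d → ℝ) : l1 (v - w) = l1 (w - v) := by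
  unfold l1
  exact Finset.sum_congr rfl fun k _ => abs_sub_comm _ _

lemma l1_sub_le (u v w : Fin d → ℝ) : l1 (u - w) ≤ l1 (u - v) + l1 (v - w) := by
  have := l1_add_le (u - v) (v - w)
  rwa [sub_add_sub_cancel] at this

lemma l1_of_mem_stdSimplex {x : Fin d → ℝ} (hx : x ∈ stdSimplex ℝ (Fin d)) : l1 x = 1 := by
  rw [← hx.2]
  exact Finset.sum_congr rfl fun k _ => abs_of_nonneg (hx.1 k)

lemma abs_dotProduct_le (v w : Fin d → ℝ) : |dotProduct v w| ≤ ‖v‖ * l1 w := by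
  unfold dotProduct l1
  rw [Finset.mul_sum]
  refine (Finset.abs_sum_le_sum_abs _ _).trans (Finset.sum_le_sum fun k _ => ?_)
  rw [abs_mul]
  exact mul_le_mul_of_nonneg_right (norm_le_pi_norm v k) (abs_nonneg _)

lemma dotProduct_le_norm_mul (v w : Fin d → ℝ) : dotProduct v w ≤ ‖v‖ * l1 w :=
  (le_abs_self _).trans (abs_dotProduct_le v w)

lemma abs_dotProduct_le_norm {v x : Fin d → ℝ} (hx : x ∈ stdSimplex ℝ (Fin d)) :
    |dotProduct v x| ≤ ‖v‖ := by
  simpa [l1_of_mem_stdSimplex hx] using abs_dotProduct_le v x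

lemma sum_dotProduct' (T : ℕ) (ν : ℕ → Fin d → ℝ) (z : Fin d → ℝ) :
    ∑ t ∈ Finset.range T, dotProduct (ν t) z = dotProduct (∑ t ∈ Finset.range T, ν t) z :=
  (sum_dotProduct _ _ _).symm

lemma stdSimplex_nonempty (hd : 2 ≤ d) : (stdSimplex ℝ (Fin d)).Nonempty :=
  ⟨_, single_mem_stdSimplex ℝ (⟨0, by omega⟩ : Fin d)⟩

/-! ### Multiplicative Weight Update -/

/-- **Hoeffding's lemma** for a finite distribution on `[-1, 1]`. -/
lemma sum_mul_exp_le {p v : Fin d → ℝ} (hp : p ∈ stdSimplex ℝ (Fin d)) (hv : ∀ k, |v k| ≤ 1)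
    (a : ℝ) : ∑ k, p k * Real.exp (a * v k) ≤ Real.exp (a * dotProduct v p + a ^ 2 / 2) := by
  let P : PMF (Fin d) := PMF.ofFintype (fun k => ENNReal.ofReal (p k)) (by
    rw [← ENNReal.ofReal_sum_of_nonneg fun k _ => hp.1 k, hp.2, ENNReal.ofReal_one])
  have hP : ∀ f : Fin d → ℝ, ∫ k, f k ∂P.toMeasure = ∑ k, p k * f k := by
    intro f
    rw [PMF.integral_eq_sum]
    refine Finset.sum_congr rfl fun k _ => ?_
    simp [P, PMF.ofFintype_apply, ENNReal.toReal_ofReal (hp.1 k)]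
  have hsub := ProbabilityTheory.hasSubgaussianMGF_of_mem_Icc (μ := P.toMeasure) (X := v)
    (a := -1) (b := 1) (measurable_of_finite v).aemeasurable
    (Filter.Eventually.of_forall fun k => abs_le.1 (hv k))
  have hm := hsub.mgf_le a
  have hc : dotProduct v p = ∑ k, p k * v k := by
    simp [dotProduct, mul_comm]
  rw [ProbabilityTheory.mgf, hP, hP, ← hc] at hm
  have hK : ((((‖(1:ℝ) - -1‖₊ / 2) ^ 2 : NNReal)) : ℝ) = 1 := by
    norm_num
  rw [hK, one_mul] at hm
  have : ∀ k, p k * Real.exp (a * (v k - dotProduct v p)) =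
      Real.exp (-(a * dotProduct v p)) * (p k * Real.exp (a * v k)) := by
    intro k
    rw [mul_sub, sub_eq_add_neg, Real.exp_add]
    ring
  simp only [this, ← Finset.mul_sum] at hm
  rw [Real.exp_neg, inv_mul_le_iff₀ (Real.exp_pos _), ← Real.exp_add] at hm
  exact hm

/-- The normalized log-sum-exp potential. -/
noncomputable def softMax (a : ℝ) (S : Fin d → ℝ) : ℝ :=
  Real.log (∑ k, (d : ℝ)⁻¹ * Real.exp (a * S k)) / a

lemma sum_inv_mul_exp_pos (hd : 2 ≤ d) (a : ℝ) (S : Fin d → ℝ) :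
    0 < ∑ k, (d : ℝ)⁻¹ * Real.exp (a * S k) := by
  have : Nonempty (Fin d) := ⟨⟨0, by omega⟩⟩
  have : (0 : ℝ) < d := by exact_mod_cast (by omega : 0 < d)
  exact Finset.sum_pos (fun k _ => by positivity) Finset.univ_nonempty

/-- The power mean inequality for the uniform weights `1/d`. It makes lowering the learning rate
between rounds free of charge in `mwu_regret_le`. -/
lemma softMax_mono (hd : 2 ≤ d) {a b : ℝ} (ha : 0 < a) (hab : a ≤ b) (S : Fin d → ℝ) :
    softMax a S ≤ softMax b S := by
  have hd' : (0 : ℝ) < d := by exact_mod_cast (by omega : 0 < d)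
  have h := Real.arith_mean_le_rpow_mean Finset.univ (fun _ : Fin d => (d : ℝ)⁻¹)
    (fun k => Real.exp (a * S k)) (fun _ _ => by positivity)
    (by simp [hd'.ne']) (fun _ _ => (Real.exp_pos _).le) ((one_le_div ha).2 hab)
  have hb : 0 < b := ha.trans_le hab
  have he : ∀ k, Real.exp (a * S k) ^ (b / a) = Real.exp (b * S k) := by
    intro k
    rw [← Real.exp_mul]
    congr 1
    field_simp
  simp only [he] at h
  have hl := Real.log_le_log (sum_inv_mul_exp_pos hd a S) h
  rw [Real.log_rpow (sum_inv_mul_exp_pos hd b S)] at hl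
  unfold softMax
  rw [div_le_iff₀ ha]
  calc _ ≤ _ := hl
    _ = _ := by field_simp

/-- The increment of the potential is the log moment generating function of `v` under the current
weights, which Hoeffding's lemma bounds. -/
lemma softMax_add_le (hd : 2 ≤ d) {a : ℝ} (ha : 0 < a) (S v : Fin d → ℝ) (hv : ∀ k, |v k| ≤ 1)
    {p : Fin d → ℝ} (hp : ∀ k, p k = Real.exp (a * S k) / ∑ j, Real.exp (a * S j)) :
    softMax a (S + v) ≤ softMax a S + dotProduct v p + a / 2 := by
  have hne : Nonempty (Fin d) := ⟨⟨0, by omega⟩⟩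
  have hZ : 0 < ∑ j, Real.exp (a * S j) :=
    Finset.sum_pos (fun k _ => Real.exp_pos _) Finset.univ_nonempty
  have hps : p ∈ stdSimplex ℝ (Fin d) := by
    refine ⟨fun k => ?_, ?_⟩
    · rw [hp]; positivity
    · simp only [hp]
      rw [← Finset.sum_div, div_self hZ.ne']
  have h := sum_mul_exp_le hps hv a
  have he : ∑ k, (d : ℝ)⁻¹ * Real.exp (a * (S + v) k) =
      (∑ k, (d : ℝ)⁻¹ * Real.exp (a * S k)) * ∑ k, p k * Real.exp (a * v k) := by
    simp only [hp, ← Finset.mul_sum, Pi.add_apply, mul_add, Real.exp_add]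
    rw [mul_assoc, Finset.mul_sum Finset.univ _ (∑ j, Real.exp (a * S j))]
    congr 1
    refine Finset.sum_congr rfl fun k _ => ?_
    field_simp
  have hpos : 0 < ∑ k, p k * Real.exp (a * v k) := by
    refine Finset.sum_pos (fun k _ => ?_) Finset.univ_nonempty
    rw [hp]; positivity
  have hl := Real.log_le_log hpos h
  rw [Real.log_exp] at hl
  unfold softMax
  rw [he, Real.log_mul (sum_inv_mul_exp_pos hd a S).ne' hpos.ne', add_div]
  have : Real.log (∑ k, p k * Real.exp (a * v k)) / a ≤ dotProduct v p + a / 2 := by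
    rw [div_le_iff₀ ha]
    calc _ ≤ _ := hl
      _ = _ := by ring
  linarith

lemma le_softMax (hd : 2 ≤ d) {a : ℝ} (ha : 0 < a) (S : Fin d → ℝ) (k : Fin d) :
    S k - Real.log d / a ≤ softMax a S := by
  have hd' : (0 : ℝ) < d := by exact_mod_cast (by omega : 0 < d)
  have h1 : (d : ℝ)⁻¹ * Real.exp (a * S k) ≤ ∑ k, (d : ℝ)⁻¹ * Real.exp (a * S k) :=
    Finset.single_le_sum (f := fun k => (d : ℝ)⁻¹ * Real.exp (a * S k))
      (fun _ _ => by positivity) (Finset.mem_univ k)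
  have h2 := Real.log_le_log (by positivity) h1
  rw [Real.log_mul (by positivity) (Real.exp_pos _).ne', Real.log_exp, Real.log_inv] at h2
  unfold softMax
  rw [le_div_iff₀ ha, sub_mul, div_mul_cancel₀ _ ha.ne']
  linarith

lemma sum_inv_sqrt_le (T : ℕ) :
    ∑ t ∈ Finset.range T, 1 / √((t : ℝ) + 1) ≤ 2 * √T := by
  induction T with
  | zero => simp
  | succ T ih =>
    rw [Finset.sum_range_succ]
    have h : 1 / √((T : ℝ) + 1) ≤ 2 * √((T : ℝ) + 1) - 2 * √T := by
      have h1 : 0 < √((T : ℝ) + 1) := Real.sqrt_pos.2 (by positivity)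
      have h2 := Real.sq_sqrt (show (0 : ℝ) ≤ T + 1 by positivity)
      have h3 := Real.sq_sqrt (show (0 : ℝ) ≤ T by positivity)
      rw [div_le_iff₀ h1]
      nlinarith [sq_nonneg (√((T : ℝ) + 1) - √T)]
    push_cast
    linarith

/-- The regret of Multiplicative Weight Update with decreasing learning rate. -/
lemma mwu_regret_le (hd : 2 ≤ d) {ν : ℕ → Fin d → ℝ} (hν : ∀ t k, |ν t k| ≤ 1)
    {z : Fin d → ℝ} (hz : z ∈ stdSimplex ℝ (Fin d)) (T : ℕ) :
    ∑ t ∈ Finset.range T, dotProduct (ν t) z -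
      ∑ t ∈ Finset.range T, dotProduct (ν t) (mwu ν t) ≤ 4 * √(T * Real.log d) := by
  have hd1 : (1 : ℝ) < d := by exact_mod_cast (by omega : 1 < d)
  have hlog : 0 < Real.log d := Real.log_pos hd1
  let a : ℕ → ℝ := fun t => √(Real.log d / (t + 1))
  have ha : ∀ t, 0 < a t := fun t => Real.sqrt_pos.2 (by positivity)
  let S : ℕ → Fin d → ℝ := fun t => ∑ s ∈ Finset.range t, ν s
  have key : ∀ T, softMax (a T) (S (T + 1)) ≤
      ∑ t ∈ Finset.range (T + 1), dotProduct (ν t) (mwu ν t) +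
        ∑ t ∈ Finset.range (T + 1), a t / 2 := by
    have hstep : ∀ T, softMax (a T) (S (T + 1)) ≤
        softMax (a T) (S T) + dotProduct (ν T) (mwu ν T) + a T / 2 := by
      intro T
      have : S (T + 1) = S T + ν T := Finset.sum_range_succ _ _
      rw [this]
      refine softMax_add_le hd (ha T) _ _ (hν T) fun k => ?_
      simp [mwu, a, S, Finset.sum_apply]
    intro T
    induction T with
    | zero =>
      have h := hstep 0
      have h0 : softMax (a 0) (S 0) = 0 := by
        have : (d : ℝ) ≠ 0 := by positivity
        simp [softMax, S, this]
      simpa [h0] using h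
    | succ T ih =>
      have h := hstep (T + 1)
      have hanti : a (T + 1) ≤ a T := by
        refine Real.sqrt_le_sqrt ?_
        push_cast
        gcongr
        linarith
      have hm := softMax_mono hd (ha (T + 1)) hanti (S (T + 1))
      rw [Finset.sum_range_succ _ (T + 1), Finset.sum_range_succ _ (T + 1)]
      linarith
  rcases T with _ | T
  · simp
  have h1 := key T
  have h2 : ∑ t ∈ Finset.range (T + 1), dotProduct (ν t) z ≤
      softMax (a T) (S (T + 1)) + Real.log d / a T := by
    rw [sum_dotProduct']
    calc dotProduct (S (T + 1)) z
        ≤ ∑ k, (softMax (a T) (S (T + 1)) + Real.log d / a T) * z k := by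
          refine Finset.sum_le_sum fun k _ => mul_le_mul_of_nonneg_right ?_ (hz.1 k)
          have := le_softMax hd (ha T) (S (T + 1)) k
          linarith
      _ = _ := by rw [← Finset.mul_sum, hz.2, mul_one]
  have h3 : Real.log d / a T = √((T + 1 : ℕ) * Real.log d) := by
    rw [div_eq_iff (ha T).ne', ← Real.sqrt_mul (by positivity)]
    rw [eq_comm, Real.sqrt_eq_iff_mul_self_eq (by positivity) hlog.le]
    push_cast
    field_simp
  have h4 : ∑ t ∈ Finset.range (T + 1), a t / 2 ≤ √((T + 1 : ℕ) * Real.log d) := by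
    have e : ∀ t : ℕ, a t / 2 = √(Real.log d) / 2 * (1 / √((t : ℝ) + 1)) := by
      intro t
      simp only [a]
      rw [Real.sqrt_div hlog.le]
      ring
    simp only [e]
    rw [← Finset.mul_sum, Real.sqrt_mul (by positivity)]
    have := mul_le_mul_of_nonneg_left (sum_inv_sqrt_le (T + 1))
      (show 0 ≤ √(Real.log d) / 2 by positivity)
    linarith
  have h5 : 0 ≤ √((T + 1 : ℕ) * Real.log d) := Real.sqrt_nonneg _
  linarith

/-! ### Rewards of a game -/

lemma sum_prod_erase {n : ℕ} (i : Fin n) (ξ : Fin d) (x : Fin n → Fin d → ℝ)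
    (hx : ∀ j, x j ∈ stdSimplex ℝ (Fin d)) :
    ∑ s : Fin n → Fin d, (if s i = ξ then ∏ j ∈ Finset.univ.erase i, x j (s j) else 0) = 1 := by
  -- Replacing player `i`'s strategy by the point mass at `ξ` turns the sum into the total mass of a
  -- product distribution.
  let y : Fin n → Fin d → ℝ := Function.update x i (Pi.single ξ 1)
  have h : ∏ j, ∑ k, y j k = 1 := by
    refine Finset.prod_eq_one fun j _ => ?_
    by_cases hj : j = i
    · subst hj; simp [y]
    · simpa [y, hj] using (hx j).2
  rw [Finset.prod_univ_sum, Fintype.piFinset_univ] at h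
  rw [← h]
  refine Finset.sum_congr rfl fun s _ => ?_
  rw [← Finset.mul_prod_erase Finset.univ _ (Finset.mem_univ i)]
  have : ∏ j ∈ Finset.univ.erase i, y j (s j) = ∏ j ∈ Finset.univ.erase i, x j (s j) :=
    Finset.prod_congr rfl fun j hj => by simp [y, Finset.ne_of_mem_erase hj]
  rw [this]
  by_cases hs : s i = ξ
  · simp [y, hs]
  · simp [y, hs]

lemma abs_reward_le {n : ℕ} {L : ℝ} {U : Fin n → (Fin n → Fin d) → ℝ} (hU : IsBoundedSmooth L U)
    (i : Fin n) {x : Fin n → Fin d → ℝ} (hx : ∀ j, x j ∈ stdSimplex ℝ (Fin d)) (ξ : Fin d) :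
    |reward U i x ξ| ≤ 1 := by
  rw [← sum_prod_erase i ξ x hx]
  unfold reward
  refine (Finset.abs_sum_le_sum_abs _ _).trans (Finset.sum_le_sum fun s _ => ?_)
  split_ifs
  · have h0 : 0 ≤ ∏ j ∈ Finset.univ.erase i, x j (s j) :=
      Finset.prod_nonneg fun j _ => (hx j).1 _
    rw [abs_mul, abs_of_nonneg h0]
    exact mul_le_of_le_one_right h0 (hU.bounded i s)
  · simp

/-! ### Maximizers of closed regularizers -/

/-- Closedness is assumed only for sublevel sets of `ψ`. Along a convergent sequence the linear term
is eventually within `ε` of its limit, so a slightly larger sublevel set of `ψ` contains the limit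
point. -/
lemma IsRegularizer.isClosed_sub_linear {D : Set (Fin d → ℝ)} {ψ : (Fin d → ℝ) → ℝ}
    (h : IsRegularizer D ψ) (g : Fin d → ℝ) (c : ℝ) :
    IsClosed {x | x ∈ D ∧ ψ x - dotProduct g x ≤ c} := by
  refine isClosed_of_closure_subset fun x hx => ?_
  obtain ⟨u, hu, hux⟩ := mem_closure_iff_seq_limit.1 hx
  have hcont : Continuous fun z : Fin d → ℝ => dotProduct g z := by
    unfold dotProduct; fun_prop
  have hg : Tendsto (fun n => dotProduct g (u n)) atTop (𝓝 (dotProduct g x)) :=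
    (hcont.tendsto x).comp hux
  have key : ∀ ε > 0, x ∈ D ∧ ψ x ≤ c + dotProduct g x + ε := by
    intro ε hε
    refine (h.closed (c + dotProduct g x + ε)).mem_of_tendsto hux ?_
    filter_upwards [hg.eventually (gt_mem_nhds (lt_add_of_pos_right _ hε))] with n hn
    exact ⟨(hu n).1, by have := (hu n).2; linarith⟩
  refine ⟨(key 1 one_pos).1, ?_⟩
  have : ψ x ≤ c + dotProduct g x := le_of_forall_pos_le_add fun ε hε => (key ε hε).2
  linarith

lemma IsRegularizer.exists_max {D : Set (Fin d → ℝ)} {ψ : (Fin d → ℝ) → ℝ}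
    (h : IsRegularizer D ψ) (hne : D.Nonempty) (g : Fin d → ℝ) :
    ∃ x ∈ D, ∀ z ∈ D, dotProduct g z - ψ z ≤ dotProduct g x - ψ x := by
  obtain ⟨x₀, hx₀⟩ := hne
  set f : (Fin d → ℝ) → ℝ := fun x => ψ x - dotProduct g x with hf
  set K : Set (Fin d → ℝ) := {x | x ∈ D ∧ f x ≤ f x₀} with hK
  have hKc : IsCompact K :=
    (isCompact_stdSimplex ℝ (Fin d)).of_isClosed_subset (h.isClosed_sub_linear g _)
      fun x hx => h.subset_simplex hx.1
  have hlsc : LowerSemicontinuousOn f K := by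
    rw [lowerSemicontinuousOn_iff_preimage_Iic]
    intro b
    refine ⟨_, h.isClosed_sub_linear g b, ?_⟩
    ext x
    constructor
    · rintro ⟨h1, h2⟩; exact ⟨h1, h1.1, h2⟩
    · rintro ⟨h1, h2⟩; exact ⟨h1, h2.2⟩
  obtain ⟨x, hx, hmin⟩ := LowerSemicontinuousOn.exists_isMinOn
    (show K.Nonempty from ⟨x₀, hx₀, le_rfl⟩) hKc hlsc
  refine ⟨x, hx.1, fun z hz => ?_⟩
  rcases le_total (f z) (f x₀) with hz' | hz'
  · have : f x ≤ f z := hmin (show z ∈ K from ⟨hz, hz'⟩)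
    simp only [hf] at this; linarith
  · have : f x ≤ f z := hx.2.trans hz'
    simp only [hf] at this; linarith

lemma IsRegularizer.nonempty {D : Set (Fin d → ℝ)} {ψ : (Fin d → ℝ) → ℝ}
    (h : IsRegularizer D ψ) (hd : 2 ≤ d) : D.Nonempty := by
  have hd' : (0 : ℝ) < d := by exact_mod_cast (by omega : 0 < d)
  exact ⟨fun _ => (d : ℝ)⁻¹, h.interior_subset _
    ⟨fun _ => by positivity, by simp [hd'.ne']⟩ fun _ => by positivity⟩

lemma IsRegularizer.exists_lower_bound {D : Set (Fin d → ℝ)} {ψ : (Fin d → ℝ) → ℝ}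
    (h : IsRegularizer D ψ) : ∃ m, ∀ x ∈ D, m ≤ ψ x := by
  rcases D.eq_empty_or_nonempty with rfl | hne
  · exact ⟨0, by simp⟩
  · obtain ⟨x, -, hmin⟩ := h.exists_max hne 0
    exact ⟨ψ x, fun z hz => by simpa using hmin z hz⟩

/-! ### COFTRL steps as joint maximizers -/

/-- The joint objective of the learning rate and the strategy. -/
noncomputable def objective (ψ : (Fin d → ℝ) → ℝ) (α : ℝ) (r : Fin d → ℝ) (l : ℝ) (x : Fin d → ℝ) :
    ℝ := α * Real.log l + l * dotProduct r x - ψ x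

lemma bddAbove_conj {D : Set (Fin d → ℝ)} {ψ : (Fin d → ℝ) → ℝ} (h : IsRegularizer D ψ)
    (g : Fin d → ℝ) : BddAbove ((fun x => dotProduct g x - ψ x) '' D) := by
  obtain ⟨m, hm⟩ := h.exists_lower_bound
  refine ⟨‖g‖ - m, ?_⟩
  rintro _ ⟨x, hx, rfl⟩
  have h1 := (le_abs_self _).trans (abs_dotProduct_le_norm (v := g) (h.subset_simplex hx))
  have h2 := hm x hx
  simp only
  linarith

lemma le_conj {D : Set (Fin d → ℝ)} {ψ : (Fin d → ℝ) → ℝ} (h : IsRegularizer D ψ)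
    (g : Fin d → ℝ) {x : Fin d → ℝ} (hx : x ∈ D) : dotProduct g x - ψ x ≤ conj D ψ g :=
  le_csSup (bddAbove_conj h g) ⟨x, hx, rfl⟩

lemma conj_eq_of_max {D : Set (Fin d → ℝ)} {ψ : (Fin d → ℝ) → ℝ} {g x : Fin d → ℝ} (hx : x ∈ D)
    (hmax : ∀ z ∈ D, dotProduct g z - ψ z ≤ dotProduct g x - ψ x) :
    conj D ψ g = dotProduct g x - ψ x := by
  refine IsGreatest.csSup_eq ⟨⟨x, hx, rfl⟩, ?_⟩
  rintro _ ⟨z, hz, rfl⟩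
  exact hmax z hz

/-- The supremum in the conjugate is attained at the played strategy, so maximizing first over `x`
and then over the rate is one joint maximization. -/
lemma isStep_iff {D : Set (Fin d → ℝ)} {ψ : (Fin d → ℝ) → ℝ} (h : IsRegularizer D ψ)
    {α η : ℝ} {r : Fin d → ℝ} {lam : ℝ} {x : Fin d → ℝ} :
    IsStep D ψ α η r lam x ↔ lam ∈ Set.Ioc 0 η ∧ x ∈ D ∧
      ∀ l ∈ Set.Ioc 0 η, ∀ z ∈ D, objective ψ α r l z ≤ objective ψ α r lam x := by
  constructor
  · rintro ⟨⟨hl, hlmax⟩, hx, hxmax⟩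
    refine ⟨hl, hx, fun l hl' z hz => ?_⟩
    have h1 : conj D ψ (lam • r) = dotProduct (lam • r) x - ψ x :=
      conj_eq_of_max hx fun z hz => by
        simp only [smul_dotProduct, smul_eq_mul]
        exact hxmax hz
    have h2 := le_conj h (l • r) hz
    have h3 : α * Real.log l + conj D ψ (l • r) ≤ α * Real.log lam + conj D ψ (lam • r) :=
      hlmax hl'
    simp only [smul_dotProduct, smul_eq_mul] at h1 h2
    unfold objective
    linarith
  · rintro ⟨hl, hx, hmax⟩
    have hxmax : ∀ z ∈ D, lam * dotProduct r z - ψ z ≤ lam * dotProduct r x - ψ x := by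
      intro z hz
      have := hmax lam hl z hz
      unfold objective at this
      linarith
    refine ⟨⟨hl, fun l hl' => ?_⟩, hx, fun z hz => hxmax z hz⟩
    have h1 : conj D ψ (lam • r) = dotProduct (lam • r) x - ψ x :=
      conj_eq_of_max hx fun z hz => by
        simpa only [smul_dotProduct, smul_eq_mul] using hxmax z hz
    have h2 : conj D ψ (l • r) ≤ objective ψ α r lam x - α * Real.log l := by
      refine csSup_le (Set.Nonempty.image _ ⟨x, hx⟩) ?_
      rintro _ ⟨z, hz, rfl⟩
      have := hmax l hl' z hz
      simp only [smul_dotProduct, smul_eq_mul]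
      unfold objective at this ⊢
      linarith
    show α * Real.log l + conj D ψ (l • r) ≤ α * Real.log lam + conj D ψ (lam • r)
    simp only [smul_dotProduct, smul_eq_mul] at h1
    unfold objective at h2
    linarith

lemma conj_smul_le {D : Set (Fin d → ℝ)} {ψ : (Fin d → ℝ) → ℝ} (h : IsRegularizer D ψ)
    (hne : D.Nonempty) (r : Fin d → ℝ) (a b : ℝ) :
    conj D ψ (a • r) ≤ conj D ψ (b • r) + ‖r‖ * |a - b| := by
  refine csSup_le (hne.image _) ?_
  rintro _ ⟨z, hz, rfl⟩
  have h1 := le_conj h (b • r) hz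
  have h2 := abs_dotProduct_le_norm (v := r) (h.subset_simplex hz)
  have h3 : (a - b) * dotProduct r z ≤ |a - b| * ‖r‖ := by
    refine (le_abs_self _).trans ?_
    rw [abs_mul]
    exact mul_le_mul_of_nonneg_left h2 (abs_nonneg _)
  simp only [smul_dotProduct, smul_eq_mul] at h1 ⊢
  linarith

/-- COFTRL steps exist. -/
lemma IsRegularizer.exists_isStep {D : Set (Fin d → ℝ)} {ψ : (Fin d → ℝ) → ℝ}
    (h : IsRegularizer D ψ) (hd : 2 ≤ d) {α η : ℝ} (hα : 0 < α) (hη : 0 < η) (r : Fin d → ℝ) :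
    ∃ lam x, IsStep D ψ α η r lam x := by
  have hne := h.nonempty hd
  set Λ : ℝ → ℝ := fun l => α * Real.log l + conj D ψ (l • r) with hΛ
  -- Below this `δ` the logarithm has dropped by at least `η‖r‖/α`, more than compensating any gain
  -- in the conjugate compared with the rate `η`. The search is thus confined to the compact
  -- interval `[δ, η]`.
  set δ : ℝ := η * Real.exp (-(η * ‖r‖ / α)) with hδ
  have hδ0 : 0 < δ := by positivity
  have hδη : δ ≤ η := mul_le_of_le_one_right hη.le (Real.exp_le_one_iff.2 (by
    have : 0 ≤ η * ‖r‖ / α := by positivity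
    linarith))
  have hlip : LipschitzWith ‖r‖₊ fun l : ℝ => conj D ψ (l • r) :=
    LipschitzWith.of_le_add_mul _ fun a b => by
      simpa [Real.dist_eq] using conj_smul_le h hne r a b
  have hcont : ContinuousOn Λ (Set.Icc δ η) := by
    refine ContinuousOn.add (continuousOn_const.mul ?_) hlip.continuous.continuousOn
    exact Real.continuousOn_log.mono fun l hl => (hδ0.trans_le hl.1).ne'
  obtain ⟨lam, hlam, hmax⟩ := isCompact_Icc.exists_isMaxOn ⟨η, hδη, le_rfl⟩ hcont
  obtain ⟨x, hx, hxmax⟩ := h.exists_max hne (lam • r)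
  refine ⟨lam, x, ⟨⟨hδ0.trans_le hlam.1, hlam.2⟩, fun l hl => ?_⟩, hx, fun z hz => ?_⟩
  · rcases le_total δ l with hl' | hl'
    · exact hmax ⟨hl', hl.2⟩
    · have hηmax : Λ η ≤ Λ lam := hmax (show η ∈ Set.Icc δ η from ⟨hδη, le_rfl⟩)
      show Λ l ≤ Λ lam
      refine le_trans ?_ hηmax
      have h1 := conj_smul_le h hne r l η
      have h2 : Real.log l ≤ Real.log η - η * ‖r‖ / α := by
        have := Real.log_le_log hl.1 hl'
        rwa [hδ, Real.log_mul hη.ne' (Real.exp_pos _).ne', Real.log_exp, ← sub_eq_add_neg] at this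
      have h3 : |l - η| ≤ η := by
        rw [abs_le]; constructor <;> linarith [hl.1, hl.2]
      have h4 := mul_le_mul_of_nonneg_left h2 hα.le
      have h5 := mul_le_mul_of_nonneg_left h3 (norm_nonneg r)
      rw [mul_sub, mul_div_cancel₀ _ hα.ne'] at h4
      show α * Real.log l + conj D ψ (l • r) ≤ α * Real.log η + conj D ψ (η • r)
      linarith
  · have := hxmax z hz
    simp only [smul_dotProduct, smul_eq_mul] at this
    exact this

/-! ### First-order optimality of a step -/

lemma convex_segment_mem {D : Set (Fin d → ℝ)} {ψ : (Fin d → ℝ) → ℝ} (h : IsRegularizer D ψ)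
    {x z : Fin d → ℝ} (hx : x ∈ D) (hz : z ∈ D) {t : ℝ} (h0 : 0 ≤ t) (h1 : t ≤ 1) :
    x + t • (z - x) ∈ D :=
  h.convexOn.1.add_smul_sub_mem hx hz ⟨h0, h1⟩

lemma IsStep.slope_le {D : Set (Fin d → ℝ)} {ψ : (Fin d → ℝ) → ℝ} (h : IsRegularizer D ψ)
    {α η : ℝ} {r : Fin d → ℝ} {lam : ℝ} {x z : Fin d → ℝ} (hs : IsStep D ψ α η r lam x)
    (hz : z ∈ D) {t : ℝ} (h0 : 0 ≤ t) (h1 : t ≤ 1) :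
    t * (lam * dotProduct r (z - x)) ≤ ψ (x + t • (z - x)) - ψ x := by
  have : lam * dotProduct r (x + t • (z - x)) - ψ (x + t • (z - x)) ≤
      lam * dotProduct r x - ψ x :=
    hs.2.2 (convex_segment_mem h hs.2.1 hz h0 h1)
  rw [dotProduct_add, dotProduct_smul, smul_eq_mul] at this
  linarith

/-- First-order optimality in the rate alone. It is only an inequality because the optimal rate may
sit at the endpoint `η`. -/
lemma IsStep.le_rate {D : Set (Fin d → ℝ)} {ψ : (Fin d → ℝ) → ℝ} (h : IsRegularizer D ψ)
    {α η : ℝ} (hα : 0 ≤ α) {r : Fin d → ℝ} {lam : ℝ} {x : Fin d → ℝ}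
    (hs : IsStep D ψ α η r lam x) {l : ℝ} (hl : l ∈ Set.Ioc 0 η) :
    α * (l - lam) / lam + (l - lam) * dotProduct r x ≤ 0 := by
  obtain ⟨hlam, hx, hmax⟩ := (isStep_iff h).1 hs
  have hlam0 := hlam.1
  have hT : Tendsto (fun t : ℝ => α * (l - lam) / (lam + t * (l - lam)) +
      (l - lam) * dotProduct r x) (𝓝[>] 0)
      (𝓝 (α * (l - lam) / (lam + 0 * (l - lam)) + (l - lam) * dotProduct r x)) := by
    refine Tendsto.mono_left ?_ nhdsWithin_le_nhds
    refine ContinuousAt.tendsto (f := fun t : ℝ => α * (l - lam) / (lam + t * (l - lam)) +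
      (l - lam) * dotProduct r x) ?_
    refine ContinuousAt.add (ContinuousAt.div (by fun_prop) (by fun_prop) ?_) (by fun_prop)
    simpa using hlam0.ne'
  rw [zero_mul, add_zero] at hT
  refine le_of_tendsto hT ?_
  filter_upwards [Ioo_mem_nhdsGT (show (0 : ℝ) < 1 by norm_num)] with t ht
  have hlt : 0 < lam + t * (l - lam) := by nlinarith [ht.1, ht.2, hl.1]
  have hm := hmax (lam + t * (l - lam)) ⟨hlt, by nlinarith [ht.1, ht.2, hl.2, hlam.2]⟩ x hx
  unfold objective at hm
  have hlog := Real.one_sub_inv_le_log_of_pos (div_pos hlt hlam0)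
  rw [Real.log_div hlt.ne' hlam0.ne', inv_div] at hlog
  have e : 1 - lam / (lam + t * (l - lam)) = t * ((l - lam) / (lam + t * (l - lam))) := by
    field_simp; ring
  rw [e] at hlog
  have h2 := mul_le_mul_of_nonneg_left hlog hα
  have h3 : t * (α * (l - lam) / (lam + t * (l - lam)) + (l - lam) * dotProduct r x) ≤ 0 := by
    have : α * (t * ((l - lam) / (lam + t * (l - lam)))) =
      t * (α * (l - lam) / (lam + t * (l - lam))) := by ring
    linarith
  exact nonpos_of_mul_nonpos_right h3 ht.1

/-- The gap of the objective is at least a Bregman-type quantity. -/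
lemma IsStep.le_objective_sub {D : Set (Fin d → ℝ)} {ψ : (Fin d → ℝ) → ℝ} (h : IsRegularizer D ψ)
    {α η : ℝ} (hα : 0 ≤ α) {r : Fin d → ℝ} {lam : ℝ} {x : Fin d → ℝ}
    (hs : IsStep D ψ α η r lam x) {l : ℝ} (hl : l ∈ Set.Ioc 0 η) (z : Fin d → ℝ) :
    α * (l / lam - 1 - Real.log (l / lam)) + (ψ z - ψ x) * (1 - l / lam) +
      l / lam * (ψ z - ψ x - lam * dotProduct r (z - x)) ≤
    objective ψ α r lam x - objective ψ α r l z := by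
  have h1 := hs.le_rate h hα hl
  have hlam0 := hs.1.1.1
  unfold objective
  rw [Real.log_div hl.1.ne' hlam0.ne', dotProduct_sub]
  have e : l / lam * (ψ z - ψ x - lam * (dotProduct r z - dotProduct r x)) =
      l / lam * (ψ z - ψ x) - l * (dotProduct r z - dotProduct r x) := by
    field_simp
  have e2 : α * (l - lam) / lam = α * (l / lam - 1) := by field_simp
  rw [e]
  rw [e2] at h1
  linarith

/-! ### Bregman divergences -/

/-- A linear lower bound along the segment bounds the one-sided derivative from below, without
requiring the difference quotients to converge or the derivative to be finite. -/
lemma bregman_le {f : (Fin d → ℝ) → ℝ} {z w : Fin d → ℝ} {c : ℝ}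
    (h : ∀ t ∈ Set.Ioo (0 : ℝ) 1, t * c ≤ f (w + t • (z - w)) - f w) :
    bregman f z w ≤ ((f z - f w - c : ℝ) : EReal) := by
  unfold bregman
  rw [EReal.coe_sub (f z - f w) c]
  refine EReal.sub_le_sub le_rfl (le_liminf_of_le (by isBoundedDefault) ?_)
  filter_upwards [Ioo_mem_nhdsGT (show (0 : ℝ) < 1 by norm_num)] with t ht
  rw [EReal.coe_le_coe_iff, le_div_iff₀ ht.1, mul_comm]
  exact h t ht

lemma IsStep.bregman_le {D : Set (Fin d → ℝ)} {ψ : (Fin d → ℝ) → ℝ} (h : IsRegularizer D ψ)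
    {α η : ℝ} {r : Fin d → ℝ} {lam : ℝ} {x z : Fin d → ℝ} (hs : IsStep D ψ α η r lam x)
    (hz : z ∈ D) :
    bregman ψ z x ≤ ((ψ z - ψ x - lam * dotProduct r (z - x) : ℝ) : EReal) :=
  COFTRL.bregman_le fun _ ht => hs.slope_le h hz ht.1.le ht.2.le

lemma IsStep.strong_convexity {D : Set (Fin d → ℝ)} {ψ : (Fin d → ℝ) → ℝ} (h : IsRegularizer D ψ)
    {μ : ℝ} (hsc : IsStronglyConvexL1 D ψ μ)
    {α η : ℝ} {r : Fin d → ℝ} {lam : ℝ} {x z : Fin d → ℝ} (hs : IsStep D ψ α η r lam x)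
    (hz : z ∈ D) :
    μ / 2 * l1 (z - x) ^ 2 ≤ ψ z - ψ x - lam * dotProduct r (z - x) := by
  have hT : Tendsto (fun t : ℝ => μ / 2 * (1 - t) * l1 (z - x) ^ 2) (𝓝[>] 0)
      (𝓝 (μ / 2 * (1 - 0) * l1 (z - x) ^ 2)) :=
    Tendsto.mono_left (Continuous.tendsto (by fun_prop) 0) nhdsWithin_le_nhds
  rw [sub_zero, mul_one] at hT
  refine le_of_tendsto hT ?_
  filter_upwards [Ioo_mem_nhdsGT (show (0 : ℝ) < 1 by norm_num)] with t ht
  have h1 := hs.slope_le h hz ht.1.le ht.2.le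
  have h2 := hsc x hs.2.1 z hz (1 - t) t (by linarith [ht.2]) ht.1.le (by ring)
  have e : (1 - t) • x + t • z = x + t • (z - x) := by
    rw [sub_smul, one_smul, smul_sub]; abel
  rw [e, l1_sub_comm x z] at h2
  have h3 : t * (μ / 2 * (1 - t) * l1 (z - x) ^ 2) ≤
      t * (ψ z - ψ x - lam * dotProduct r (z - x)) := by nlinarith
  exact le_of_mul_le_mul_left h3 ht.1

lemma sum_smul_simplex {x : Fin d → ℝ} (hx : x ∈ stdSimplex ℝ (Fin d)) (c : ℝ) :
    ∑ k, (c • x) k = c := by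
  simp [← Finset.mul_sum, hx.2]

lemma normalize_smul_simplex {x : Fin d → ℝ} (hx : x ∈ stdSimplex ℝ (Fin d)) {c : ℝ}
    (hc : 0 < c) : normalize (c • x) = x := by
  rw [normalize, sum_smul_simplex hx, smul_smul, inv_mul_cancel₀ hc.ne', one_smul]

lemma smul_mem_lifted {D : Set (Fin d → ℝ)} {ψ : (Fin d → ℝ) → ℝ} (h : IsRegularizer D ψ)
    {x : Fin d → ℝ} (hx : x ∈ D) {c : ℝ} (hc : 0 < c) (hc1 : c ≤ 1) : c • x ∈ lifted D := by
  have hx' := h.subset_simplex hx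
  refine ⟨?_, ?_, ?_⟩
  · rwa [sum_smul_simplex hx']
  · rwa [sum_smul_simplex hx']
  · rwa [normalize_smul_simplex hx' hc]

lemma liftedReg_smul {D : Set (Fin d → ℝ)} {ψ : (Fin d → ℝ) → ℝ} (h : IsRegularizer D ψ)
    (α : ℝ) {x : Fin d → ℝ} (hx : x ∈ D) {c : ℝ} (hc : 0 < c) :
    liftedReg ψ α (c • x) = -α * Real.log c + ψ x := by
  have hx' := h.subset_simplex hx
  rw [liftedReg, sum_smul_simplex hx', normalize_smul_simplex hx' hc]

/-- The Bregman divergence of the lifted regularizer at a step is at most the gap of the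
objective. -/
lemma IsStep.bregman_liftedReg_le {D : Set (Fin d → ℝ)} {ψ : (Fin d → ℝ) → ℝ}
    (h : IsRegularizer D ψ)
    {α η : ℝ} {r : Fin d → ℝ} {lam : ℝ} {x : Fin d → ℝ} (hs : IsStep D ψ α η r lam x)
    {l : ℝ} (hl : l ∈ Set.Ioc 0 η) {z : Fin d → ℝ} (hz : z ∈ D) :
    bregman (liftedReg ψ α) ((l / η) • z) ((lam / η) • x) ≤
      ((objective ψ α r lam x - objective ψ α r l z : ℝ) : EReal) := by
  obtain ⟨hlam, hx, hmax⟩ := (isStep_iff h).1 hs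
  have hη : 0 < η := hl.1.trans_le hl.2
  have hlη := div_pos hl.1 hη
  have hlamη := div_pos hlam.1 hη
  have e : objective ψ α r lam x - objective ψ α r l z =
      liftedReg ψ α ((l / η) • z) - liftedReg ψ α ((lam / η) • x) -
        (l * dotProduct r z - lam * dotProduct r x) := by
    rw [liftedReg_smul h α hz hlη, liftedReg_smul h α hx hlamη, Real.log_div hl.1.ne' hη.ne',
      Real.log_div hlam.1.ne' hη.ne']
    unfold objective
    ring
  rw [e]
  refine COFTRL.bregman_le fun t ht => ?_
  have ht1 : 0 < 1 - t := by linarith [ht.2]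
  set m : ℝ := lam + t * (l - lam) with hm
  have hm0 : 0 < m := by
    have := mul_pos ht.1 hl.1
    have := mul_pos ht1 hlam.1
    rw [hm]; linarith
  have hmη : m ≤ η := by
    have := mul_le_mul_of_nonneg_left hl.2 ht.1.le
    have := mul_le_mul_of_nonneg_left hlam.2 ht1.le
    rw [hm]; linarith
  -- A segment in the lifted domain projects to the segment from `x` to `z`, reparametrized: the
  -- lifted point at time `t` has mass `m/η` and normalizes to `w`.
  set w : Fin d → ℝ := x + (t * l / m) • (z - x) with hw
  have hwD : w ∈ D := by
    refine convex_segment_mem h hx hz (div_nonneg (mul_nonneg ht.1.le hl.1.le) hm0.le) ?_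
    rw [div_le_one hm0]
    have := mul_pos ht1 hlam.1
    rw [hm]; linarith
  have e2 : (lam / η) • x + t • ((l / η) • z - (lam / η) • x) = (m / η) • w := by
    ext k
    simp only [hw, Pi.add_apply, Pi.smul_apply, Pi.sub_apply, smul_eq_mul]
    field_simp
    rw [hm]; ring
  rw [e2, liftedReg_smul h α hwD (div_pos hm0 hη), liftedReg_smul h α hx hlamη,
    Real.log_div hm0.ne' hη.ne', Real.log_div hlam.1.ne' hη.ne']
  have h1 := hmax m ⟨hm0, hmη⟩ w hwD
  unfold objective at h1
  have h2 : m * dotProduct r w = lam * dotProduct r x +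
      t * (l * dotProduct r z - lam * dotProduct r x) := by
    rw [hw, dotProduct_add, dotProduct_smul, dotProduct_sub, smul_eq_mul]
    field_simp
    rw [hm]; ring
  rw [h2] at h1
  linarith

/-! ### Scalar inequalities -/

lemma log_le_half_sub_inv {u : ℝ} (hu : 1 ≤ u) : Real.log u ≤ (u - u⁻¹) / 2 := by
  have h := Real.self_le_sinh_iff.2 (Real.log_nonneg hu)
  rwa [Real.sinh_eq, Real.exp_neg, Real.exp_log (by linarith)] at h

/-- For `u ≥ 1` this is `log u ≤ sinh (log u)`; for `u ≤ 1` it keeps the first two terms of the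
series of `-log (1 - (1 - u))`. -/
lemma sq_le_mul_sub_log {u : ℝ} (hu : 0 < u) :
    (u - 1) ^ 2 ≤ 2 * max 1 u * (u - 1 - Real.log u) := by
  rcases le_total 1 u with h | h
  · rw [max_eq_right h]
    have h1 := log_le_half_sub_inv h
    have h2 : 2 * u * Real.log u ≤ 2 * u * ((u - u⁻¹) / 2) :=
      mul_le_mul_of_nonneg_left h1 (by linarith)
    have h3 : 2 * u * ((u - u⁻¹) / 2) = u ^ 2 - 1 := by field_simp
    nlinarith
  · rw [max_eq_left h]
    have hp : |1 - u| < 1 := by rw [abs_lt]; constructor <;> linarith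
    have hS := Real.hasSum_pow_div_log_of_abs_lt_one hp
    have := sum_le_hasSum (Finset.range 2)
      (fun n _ => by have : 0 ≤ 1 - u := by linarith
                     positivity) hS
    rw [sub_sub_cancel] at this
    norm_num [Finset.sum_range_succ] at this
    nlinarith

/-- The bound `log s ≤ (s - s⁻¹)/2` at `s = √u`, squared. Both sides are invariant under `u ↦ u⁻¹`,
so `u ≥ 1` suffices. -/
lemma log_sq_le {u : ℝ} (hu : 0 < u) : Real.log u ^ 2 ≤ (u - 1) ^ 2 / u := by
  have key : ∀ v : ℝ, 1 ≤ v → Real.log v ^ 2 ≤ (v - 1) ^ 2 / v := by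
    intro v hv
    have hv0 : 0 < v := by linarith
    have hs : 1 ≤ √v := Real.one_le_sqrt.2 hv
    have h1 := log_le_half_sub_inv hs
    rw [Real.log_sqrt hv0.le] at h1
    have h2 : Real.log v ≤ √v - (√v)⁻¹ := by linarith
    have h3 := pow_le_pow_left₀ (Real.log_nonneg hv) h2 2
    refine h3.trans (le_of_eq ?_)
    have hs0 : √v ≠ 0 := by positivity
    have e : √v - (√v)⁻¹ = (v - 1) / √v := by
      rw [eq_div_iff hs0, sub_mul, inv_mul_cancel₀ hs0, Real.mul_self_sqrt hv0.le]
    rw [e, div_pow, Real.sq_sqrt hv0.le]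
  rcases le_total 1 u with h | h
  · exact key u h
  · have := key u⁻¹ ((one_le_inv₀ hu).2 h)
    rw [Real.log_inv, neg_sq] at this
    refine this.trans (le_of_eq ?_)
    field_simp
    ring

/-- The scalar core of stability: `u` is the ratio of the rates, `Δ` the change of `ψ`, `E` and `E'`
the linearization errors of `ψ` at the two steps, `N` the distance of the strategies. The bound on
the sum of both gaps first localizes `u` near 1; there `u - 1 - log u` is quadratic and the cross
term can be absorbed. -/
lemma quadratic_gap {α γ μ u Δ E E' N : ℝ} (hγ : 0 < γ) (hμ : 0 < μ) (hα : 4 * γ + μ ≤ α)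
    (hu : 0 < u) (h1 : Δ ^ 2 ≤ γ * E) (h2 : Δ ^ 2 ≤ γ * E') (hN : μ / 2 * N ^ 2 ≤ E)
    (hS : α * (u - 1 - Real.log u) + Δ * (1 - u) + u * E +
      (α * (u⁻¹ - 1 - Real.log u⁻¹) + (-Δ) * (1 - u⁻¹) + u⁻¹ * E') ≤ 3 * γ / 10) :
    μ / 4 * (N ^ 2 + (u - 1) ^ 2) ≤
      α * (u - 1 - Real.log u) + Δ * (1 - u) + u * E := by
  have hS2 : α * (1 - u) ^ 2 + Δ * (1 - u) * (1 + u) + u ^ 2 * E + E' ≤ 3 * γ / 10 * u := by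
    have := mul_le_mul_of_nonneg_right hS hu.le
    rw [Real.log_inv] at this
    refine le_trans (le_of_eq ?_) this
    field_simp
    ring
  have hE : 0 ≤ E := le_trans (by positivity) hN
  -- Both `γE` and `γE'` are at least `Δ²`, and `1 + u² = ((1 + u)² + (1 - u)²)/2`. Completing the
  -- square costs `γ²(1 - u)²/2` out of the `4γ²(1 - u)²` supplied by `α`.
  have h3 : 7 / 2 * (1 - u) ^ 2 ≤ 3 / 10 * u := by
    have a1 := mul_le_mul_of_nonneg_left hS2 hγ.le
    have a2 : u ^ 2 * Δ ^ 2 ≤ u ^ 2 * (γ * E) := mul_le_mul_of_nonneg_left h1 (sq_nonneg u)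
    have a3 : 4 * γ * (1 - u) ^ 2 ≤ α * (1 - u) ^ 2 :=
      mul_le_mul_of_nonneg_right (by linarith) (sq_nonneg _)
    have a4 := mul_le_mul_of_nonneg_left a3 hγ.le
    have a5 : 0 ≤ (γ * (1 - u) + (1 + u) * Δ) ^ 2 := sq_nonneg _
    have a6 : 0 ≤ (1 - u) ^ 2 * Δ ^ 2 := by positivity
    have a7 : γ ^ 2 * (7 / 2 * (1 - u) ^ 2) ≤ γ ^ 2 * (3 / 10 * u) := by nlinarith
    exact le_of_mul_le_mul_left a7 (by positivity)
  have hu1 : 7 / 10 ≤ u := by nlinarith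
  have hu2 : u ≤ 3 / 2 := by nlinarith
  have hlog : (u - 1) ^ 2 / 3 ≤ u - 1 - Real.log u := by
    have b1 := sq_le_mul_sub_log hu
    have b2 : 0 ≤ u - 1 - Real.log u := by linarith [Real.log_le_sub_one_of_pos hu]
    have b3 : max 1 u ≤ 3 / 2 := max_le (by norm_num) hu2
    nlinarith
  have c1 : (4 * γ + μ) * ((u - 1) ^ 2 / 3) ≤ α * (u - 1 - Real.log u) :=
    mul_le_mul hα hlog (by positivity) (by linarith)
  -- The weights are chosen so that `4γ/3` is what `c1` provides, while `7/10 - 3/16 ≥ 1/2` of `E`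
  -- remains for the strong convexity term.
  have c2 : -(Δ * (1 - u)) ≤ 3 / 16 * E + 4 / 3 * γ * (1 - u) ^ 2 := by
    have d1 : γ * (-(Δ * (1 - u))) ≤ γ * (3 / 16 * E + 4 / 3 * γ * (1 - u) ^ 2) := by
      nlinarith [sq_nonneg (3 / 8 * Δ + γ * (1 - u))]
    exact le_of_mul_le_mul_left d1 hγ
  have c3 : 7 / 10 * E ≤ u * E := mul_le_mul_of_nonneg_right hu1 hE
  have c4 : 0 ≤ μ * (u - 1) ^ 2 := by positivity
  nlinarith

/-! ### Stability of consecutive steps -/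

/-- If two steps are close in the symmetrized Bregman divergence of the lifted regularizer, then
the gap of the objective dominates the squared change of strategy and learning rate. -/
lemma IsStep.stability {D : Set (Fin d → ℝ)} {ψ : (Fin d → ℝ) → ℝ} (h : IsRegularizer D ψ)
    {γ : ℝ → ℝ} {α μ η : ℝ} (hμ : 0 < μ) (hsc : IsStronglyConvexL1 D ψ μ)
    (hlil : IsLIL D ψ α γ) (hα : 4 * γ 1 + μ ≤ α) (hη8 : η ≤ 1 / 8) (hηγ : η ≤ 3 * γ 1 / 80)
    {r r' : Fin d → ℝ} {lam lam' : ℝ} {x x' : Fin d → ℝ}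
    (hs : IsStep D ψ α η r lam x) (hs' : IsStep D ψ α η r' lam' x')
    (hr : dotProduct (r' - r) (lam' • x' - lam • x) ≤ 8 * η) :
    μ / 4 * (l1 (x' - x) ^ 2 + (lam' / lam - 1) ^ 2) ≤
      objective ψ α r lam x - objective ψ α r lam' x' := by
  have hlam := hs.1.1
  have hlam' := hs'.1.1
  have hη : 0 < η := hlam.1.trans_le hlam.2
  have hγ : 0 < γ 1 := by linarith
  have hα0 : 0 ≤ α := by linarith
  -- Adding the two gaps cancels the logarithms and `ψ`, leaving only the pairing of the changes in
  -- regret vector and lifted play.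
  have hsum : (objective ψ α r lam x - objective ψ α r lam' x') +
      (objective ψ α r' lam' x' - objective ψ α r' lam x) =
      dotProduct (r' - r) (lam' • x' - lam • x) := by
    simp only [objective, sub_dotProduct, dotProduct_sub, dotProduct_smul, smul_eq_mul]
    ring
  have hy := smul_mem_lifted h hs.2.1 (div_pos hlam.1 hη) ((div_le_one hη).2 hlam.2)
  have hy' := smul_mem_lifted h hs'.2.1 (div_pos hlam'.1 hη) ((div_le_one hη).2 hlam'.2)
  have b1 := hs.bregman_liftedReg_le h hlam' hs'.2.1
  have b2 := hs'.bregman_liftedReg_le h hlam hs.2.1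
  have hn := normalize_smul_simplex (h.subset_simplex hs.2.1) (div_pos hlam.1 hη)
  have hn' := normalize_smul_simplex (h.subset_simplex hs'.2.1) (div_pos hlam'.1 hη)
  have hle : ((objective ψ α r lam x - objective ψ α r lam' x' : ℝ) : EReal) +
      ((objective ψ α r' lam' x' - objective ψ α r' lam x : ℝ) : EReal) ≤ ((1 : ℝ) : EReal) := by
    rw [← EReal.coe_add, EReal.coe_le_coe_iff, hsum]
    linarith
  have hγE : (0 : EReal) ≤ (γ 1 : EReal) := EReal.coe_nonneg.2 hγ.le
  have lil1 := hlil 1 one_pos _ hy' _ hy ((add_le_add b1 b2).trans hle)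
  have lil2 := hlil 1 one_pos _ hy _ hy' ((add_le_add b2 b1).trans (by rwa [add_comm]))
  rw [hn, hn'] at lil1 lil2
  have l1' := lil1.trans (mul_le_mul_of_nonneg_left (hs.bregman_le h hs'.2.1) hγE)
  have l2' := lil2.trans (mul_le_mul_of_nonneg_left (hs'.bregman_le h hs.2.1) hγE)
  rw [← EReal.coe_mul, EReal.coe_le_coe_iff, sq_abs] at l1' l2'
  rw [← neg_sub (ψ x'), neg_sq, neg_sub] at l2'
  have hN := hs.strong_convexity h hsc hs'.2.1
  have g1 := hs.le_objective_sub h hα0 hlam' x'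
  have g2 := hs'.le_objective_sub h hα0 hlam x
  have hinv : lam / lam' = (lam' / lam)⁻¹ := (inv_div _ _).symm
  rw [hinv] at g2
  refine (quadratic_gap hγ hμ hα (div_pos hlam'.1 hlam.1) l1' l2' hN ?_).trans g1
  rw [neg_sub]
  linarith

/-! ### Signals -/

lemma sub_mem_abs_le {v x z : Fin d → ℝ} (hv : ‖v‖ ≤ 1) (hx : x ∈ stdSimplex ℝ (Fin d))
    (hz : z ∈ stdSimplex ℝ (Fin d)) : |dotProduct v z - dotProduct v x| ≤ 2 := by
  have h1 := abs_le.1 ((abs_dotProduct_le_norm (v := v) hx).trans hv)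
  have h2 := abs_le.1 ((abs_dotProduct_le_norm (v := v) hz).trans hv)
  rw [abs_le]
  constructor <;> linarith [h1.1, h1.2, h2.1, h2.2]

lemma norm_signal_le {v x : Fin d → ℝ} (hv : ‖v‖ ≤ 1) (hx : x ∈ stdSimplex ℝ (Fin d)) :
    ‖signal v x‖ ≤ 2 := by
  refine (pi_norm_le_iff_of_nonneg (by norm_num)).2 fun k => ?_
  have h1 := (abs_dotProduct_le_norm (v := v) hx).trans hv
  have h2 : |v k| ≤ 1 := (norm_le_pi_norm v k).trans hv
  rw [Real.norm_eq_abs, signal]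
  exact (abs_sub _ _).trans (by linarith)

lemma signal_dotProduct {v x z : Fin d → ℝ} (hz : z ∈ stdSimplex ℝ (Fin d)) :
    dotProduct (signal v x) z = dotProduct v z - dotProduct v x := by
  have : ∑ k, (v k - dotProduct v x) * z k = dotProduct v z - dotProduct v x * ∑ k, z k := by
    rw [Finset.mul_sum]
    simp only [sub_mul, Finset.sum_sub_distrib]
    rfl
  rw [hz.2, mul_one] at this
  exact this

/-- The change splits into `v' - v`, its mean under `x'`, and the pairing of `v` with `x' - x`; the
first two account for the factor 2. -/
lemma norm_signal_sub_le {v v' x x' : Fin d → ℝ} (hv : ‖v‖ ≤ 1)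
    (hx' : x' ∈ stdSimplex ℝ (Fin d)) :
    ‖signal v' x' - signal v x‖ ≤ 2 * ‖v' - v‖ + l1 (x' - x) := by
  have hl := l1_nonneg (x' - x)
  refine (pi_norm_le_iff_of_nonneg (by positivity)).2 fun k => ?_
  have h1 := abs_le.1 (abs_dotProduct_le_norm (v := v' - v) hx')
  have h2 := abs_le.1 (abs_dotProduct_le v (x' - x))
  have h3 : ‖v‖ * l1 (x' - x) ≤ l1 (x' - x) := mul_le_of_le_one_left hl hv
  have h4 := abs_le.1 (norm_le_pi_norm (v' - v) k)
  rw [sub_dotProduct] at h1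
  rw [dotProduct_sub] at h2
  simp only [Pi.sub_apply] at h4
  rw [Real.norm_eq_abs, Pi.sub_apply, signal, signal, abs_le]
  constructor <;> linarith [h1.1, h1.2, h2.1, h2.2, h4.1, h4.2]

/-! ### The regret bound of COFTRL -/

/-- The assumptions under which COFTRL is analysed; `R T` bounds the range of the regularizer on
comparators for the horizon `T`. -/
structure IsAdmissible (D : Set (Fin d → ℝ)) (ψ : (Fin d → ℝ) → ℝ) (γ : ℝ → ℝ) (n : ℕ)
    (L μ α η : ℝ) (R : ℕ → ℝ) : Prop where
  two_le : 2 ≤ d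
  one_le : 1 ≤ n
  smoothness_pos : 0 < L
  reg : IsRegularizer D ψ
  mu_pos : 0 < μ
  strong : IsStronglyConvexL1 D ψ μ
  lil : IsLIL D ψ α γ
  alpha_ge : 4 * γ 1 + μ ≤ α
  rate_pos : 0 < η
  rate_le : η ≤ rateCap (γ 1) μ L n
  comparator : ∀ T : ℕ, 1 ≤ T → ∀ z ∈ stdSimplex ℝ (Fin d), ∃ x ∈ D,
    (∀ w ∈ D, ψ x ≤ ψ w + R T) ∧ l1 (z - x) ≤ 2 / T
  mono : ∀ m T : ℕ, 1 ≤ m → m ≤ T → R m ≤ R T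

namespace IsAdmissible

variable {D : Set (Fin d → ℝ)} {ψ : (Fin d → ℝ) → ℝ} {γ : ℝ → ℝ} {n : ℕ} {L μ α η : ℝ}
  {R : ℕ → ℝ}

lemma rate_le_lil (h : IsAdmissible D ψ γ n L μ α η R) : η ≤ 3 * γ 1 / 80 :=
  h.rate_le.trans ((min_le_left _ _).trans (min_le_left _ _))

lemma rate_le_eighth (h : IsAdmissible D ψ γ n L μ α η R) : η ≤ 1 / 8 :=
  h.rate_le.trans ((min_le_left _ _).trans (min_le_right _ _))

/-- Positivity of `γ 1` is forced by the existence of a positive rate below the cap. -/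
lemma gamma_pos (h : IsAdmissible D ψ γ n L μ α η R) : 0 < γ 1 := by
  linarith [h.rate_le_lil, h.rate_pos]

lemma alpha_pos (h : IsAdmissible D ψ γ n L μ α η R) : 0 < α := by
  linarith [h.gamma_pos, h.alpha_ge, h.mu_pos]

lemma rate_mul_sqrt_two (h : IsAdmissible D ψ γ n L μ α η R) : η * (32 * √2) ≤ μ :=
  (le_div_iff₀ (by positivity)).1
    (h.rate_le.trans ((min_le_right _ _).trans (min_le_left _ _)))

lemma rate_mul_smoothness (h : IsAdmissible D ψ γ n L μ α η R) :
    η * (32 * √6 * L * n) ≤ μ := by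
  have hn : (0 : ℝ) < n := by exact_mod_cast h.one_le
  have hL := h.smoothness_pos
  exact (le_div_iff₀ (by positivity)).1
    (h.rate_le.trans ((min_le_right _ _).trans (min_le_right _ _)))

lemma rate_mul_le (h : IsAdmissible D ψ γ n L μ α η R) : η * 32 ≤ μ := by
  have h1 := h.rate_mul_sqrt_two
  have h2 : (1 : ℝ) ≤ √2 := Real.one_le_sqrt.2 (by norm_num)
  have := h.rate_pos
  nlinarith

lemma rate_sq_le (h : IsAdmissible D ψ γ n L μ α η R) : 2048 * η ^ 2 ≤ μ ^ 2 := by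
  have h1 := pow_le_pow_left₀ (by have := h.rate_pos; positivity) h.rate_mul_sqrt_two 2
  rw [mul_pow, mul_pow, Real.sq_sqrt (by norm_num)] at h1
  linarith

lemma rate_sq_smoothness_le (h : IsAdmissible D ψ γ n L μ α η R) :
    6144 * η ^ 2 * (L ^ 2 * n ^ 2) ≤ μ ^ 2 := by
  have h1 := pow_le_pow_left₀
    (by have := h.rate_pos; have := h.smoothness_pos; positivity) h.rate_mul_smoothness 2
  rw [mul_pow, mul_pow, mul_pow, mul_pow, Real.sq_sqrt (by norm_num)] at h1
  linarith

lemma range_nonneg (h : IsAdmissible D ψ γ n L μ α η R) {T : ℕ} (hT : 1 ≤ T) : 0 ≤ R T := by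
  obtain ⟨z, hz⟩ := stdSimplex_nonempty h.two_le
  obtain ⟨x, hx, h1, -⟩ := h.comparator T hT z hz
  linarith [h1 x hx]

lemma exists_isStep (h : IsAdmissible D ψ γ n L μ α η R) (r : Fin d → ℝ) :
    ∃ lam x, IsStep D ψ α η r lam x :=
  h.reg.exists_isStep h.two_le h.alpha_pos h.rate_pos r

lemma stability (h : IsAdmissible D ψ γ n L μ α η R) {r r' : Fin d → ℝ} {lam lam' : ℝ}
    {x x' : Fin d → ℝ} (hs : IsStep D ψ α η r lam x) (hs' : IsStep D ψ α η r' lam' x')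
    (hr : ‖r' - r‖ ≤ 4) :
    μ / 4 * (l1 (x' - x) ^ 2 + (lam' / lam - 1) ^ 2) ≤
      objective ψ α r lam x - objective ψ α r lam' x' := by
  refine hs.stability h.reg h.mu_pos h.strong h.lil h.alpha_ge h.rate_le_eighth h.rate_le_lil hs' ?_
  have h1 := abs_le.1 (abs_dotProduct_le_norm (v := r' - r) (h.reg.subset_simplex hs.2.1))
  have h2 := abs_le.1 (abs_dotProduct_le_norm (v := r' - r) (h.reg.subset_simplex hs'.2.1))
  have hl := hs.1.1
  have hl' := hs'.1.1
  rw [dotProduct_sub, dotProduct_smul, dotProduct_smul, smul_eq_mul, smul_eq_mul]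
  nlinarith [h1.1, h2.2, hl.1, hl.2, hl'.1, hl'.2, mul_le_mul_of_nonneg_left h2.2 hl'.1.le,
    mul_le_mul_of_nonneg_left h1.1 hl.1.le, mul_le_mul_of_nonneg_left hr hl'.1.le,
    mul_le_mul_of_nonneg_left hr hl.1.le]

/-- One round of optimistic follow the regularized leader: the value of the leader increases by at
most the squared prediction error minus the squared movement. -/
lemma leader_step (h : IsAdmissible D ψ γ n L μ α η R) {S m u : Fin d → ℝ} {lz lx lz' : ℝ}
    {z x z' : Fin d → ℝ} (hz : IsStep D ψ α η S lz z) (hx : IsStep D ψ α η (S + m) lx x)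
    (hz' : IsStep D ψ α η (S + u) lz' z') (hm : ‖m‖ ≤ 2) (hu : ‖u‖ ≤ 2)
    (hux : dotProduct u x = 0) :
    objective ψ α (S + u) lz' z' ≤ objective ψ α S lz z + 4 * η ^ 2 / μ * ‖u - m‖ ^ 2 -
      μ / 8 * l1 (z' - x) ^ 2 - μ / 4 * l1 (x - z) ^ 2 := by
  have hμ := h.mu_pos
  have h1 := h.stability hz hx (by rw [add_sub_cancel_left]; linarith)
  have h2 := h.stability hx hz' (by
    rw [add_sub_add_left_eq_sub]; exact (norm_sub_le _ _).trans (by linarith))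
  have hlx := hx.1.1
  have hlz' := hz'.1.1
  -- The term `lx ⟨u, x⟩` that this identity would otherwise contain vanishes by `hux`: this is the
  -- purpose of the corrected signal.
  have e : objective ψ α (S + u) lz' z' = objective ψ α S lx x -
      (objective ψ α (S + m) lx x - objective ψ α (S + m) lz' z') +
      dotProduct (u - m) (lz' • z' - lx • x) := by
    simp only [objective, add_dotProduct, sub_dotProduct, dotProduct_sub, dotProduct_smul,
      smul_eq_mul, hux]
    ring
  set a := |lz' / lx - 1| with ha
  set b := l1 (z' - x) with hb
  have h3 : l1 (lz' • z' - lx • x) ≤ η * (a + b) := by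
    have e2 : lz' • z' - lx • x = (lz' - lx) • z' + lx • (z' - x) := by
      rw [sub_smul, smul_sub]; abel
    rw [e2]
    refine (l1_add_le _ _).trans ?_
    rw [l1_smul, l1_smul, l1_of_mem_stdSimplex (h.reg.subset_simplex hz'.2.1), mul_one,
      abs_of_pos hlx.1]
    have e3 : |lz' - lx| = lx * a := by
      rw [ha, ← abs_of_pos hlx.1, ← abs_mul, abs_of_pos hlx.1, mul_sub, mul_one,
        mul_div_cancel₀ _ hlx.1.ne']
    rw [e3, ← mul_add]
    exact mul_le_mul_of_nonneg_right hlx.2 (add_nonneg (abs_nonneg _) (l1_nonneg _))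
  have h4 := dotProduct_le_norm_mul (u - m) (lz' • z' - lx • x)
  have h5 := mul_le_mul_of_nonneg_left h3 (norm_nonneg (u - m))
  -- Young's inequality with weights spending half of the stability gain `μ/4`; the other half
  -- survives for the movement `b`.
  have h6 : ‖u - m‖ * (η * (a + b)) ≤ 4 * η ^ 2 / μ * ‖u - m‖ ^ 2 + μ / 8 * (a ^ 2 + b ^ 2) := by
    set δ := ‖u - m‖
    have e4 : 4 * η ^ 2 / μ * δ ^ 2 + μ / 8 * (a ^ 2 + b ^ 2) - δ * (η * (a + b)) =
      μ / 8 * ((a - 4 * (η * δ / μ)) ^ 2 + (b - 4 * (η * δ / μ)) ^ 2) := by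
      field_simp
      ring
    have : 0 ≤ μ / 8 * ((a - 4 * (η * δ / μ)) ^ 2 + (b - 4 * (η * δ / μ)) ^ 2) := by positivity
    linarith
  have h7 : (lz' / lx - 1) ^ 2 = a ^ 2 := (sq_abs _).symm
  rw [h7] at h2
  have h8 : 0 ≤ μ / 4 * (lx / lz - 1) ^ 2 := by positivity
  have h9 : 0 ≤ μ * a ^ 2 := by positivity
  rw [mul_add] at h1
  linarith

/-- Regret bounded by variation in utilities, in a form that also shows that the bound is
nonnegative. -/
theorem regret_le_variation (h : IsAdmissible D ψ γ n L μ α η R) {ν x : ℕ → Fin d → ℝ} {T : ℕ}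
    (hT : 1 ≤ T) (hν : ∀ t < T, ‖ν t‖ ≤ 1) (hstep : ∀ t < T, StepAt D ψ α η ν x t) {w : ℝ}
    (hw : w = 0 ∨ ∃ z ∈ stdSimplex ℝ (Fin d), w =
      ∑ t ∈ Finset.range T, dotProduct (ν t) z - ∑ t ∈ Finset.range T, dotProduct (ν t) (x t)) :
    w ≤ 3 + (α * Real.log T + R T) / η +
      24 * η / μ * ∑ s ∈ Finset.range (T - 1), ‖ν (s + 1) - ν s‖ ^ 2 -
      μ / (16 * η) * ∑ s ∈ Finset.range (T - 1), l1 (x (s + 1) - x s) ^ 2 := by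
  have hμ := h.mu_pos
  have hη := h.rate_pos
  have hα := h.alpha_pos
  choose lz z hz using h.exists_isStep
  set u : ℕ → Fin d → ℝ := fun t => signal (ν t) (x t) with hu
  set S : ℕ → Fin d → ℝ := fun t => ∑ s ∈ Finset.range t, u s with hS
  have hxs : ∀ t < T, x t ∈ stdSimplex ℝ (Fin d) := fun t ht => by
    obtain ⟨l, hl⟩ := hstep t ht
    exact h.reg.subset_simplex hl.2.1
  have hun : ∀ t < T, ‖u t‖ ≤ 2 := fun t ht => norm_signal_le (hν t ht) (hxs t ht)
  have hux : ∀ t < T, dotProduct (u t) (x t) = 0 := fun t ht => by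
    rw [hu, signal_dotProduct (hxs t ht), sub_self]
  have hSs : ∀ t, S (t + 1) = S t + u t := fun t => Finset.sum_range_succ _ _
  set V : ℕ → ℝ := fun t => objective ψ α (S t) (lz (S t)) (z (S t)) with hV
  -- The extra movement term on the left is carried to the next round to build the path length. The
  -- constant 4 bounds the squared first signal, whose prediction is zero.
  have key : ∀ k < T, V (k + 1) + μ / 8 * l1 (z (S (k + 1)) - x k) ^ 2 ≤
      V 0 + 4 * η ^ 2 / μ * (4 + ∑ s ∈ Finset.range k, ‖u (s + 1) - u s‖ ^ 2) -
        μ / 12 * ∑ s ∈ Finset.range k, l1 (x (s + 1) - x s) ^ 2 := by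
    intro k
    induction k with
    | zero =>
      intro hk
      obtain ⟨l, hl⟩ := hstep 0 hk
      have h0 : optRegret ν x 0 = S 0 + 0 := by simp [optRegret, hS]
      rw [h0] at hl
      have h1 := h.leader_step (hz (S 0)) hl (hSs 0 ▸ hz (S 1)) (by simp) (hun 0 hk) (hux 0 hk)
      rw [← hSs 0, sub_zero] at h1
      have h2 : ‖u 0‖ ^ 2 ≤ 2 ^ 2 := pow_le_pow_left₀ (norm_nonneg _) (hun 0 hk) 2
      have h3 : 4 * η ^ 2 / μ * ‖u 0‖ ^ 2 ≤ 4 * η ^ 2 / μ * 2 ^ 2 :=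
        mul_le_mul_of_nonneg_left h2 (by positivity)
      have h4 : 0 ≤ μ / 4 * l1 (x 0 - z (S 0)) ^ 2 := by positivity
      simp only [Finset.range_zero, Finset.sum_empty, hV]
      simp only [zero_add] at h1 ⊢
      linarith
    | succ k ih =>
      intro hk
      have ih := ih (by omega)
      obtain ⟨l, hl⟩ := hstep (k + 1) hk
      have h0 : optRegret ν x (k + 1) = S (k + 1) + u k := rfl
      rw [h0] at hl
      have h1 := h.leader_step (hz (S (k + 1))) hl (hSs (k + 1) ▸ hz (S (k + 1 + 1)))
        (hun k (by omega)) (hun (k + 1) hk) (hux (k + 1) hk)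
      rw [← hSs (k + 1)] at h1
      rw [Finset.sum_range_succ, Finset.sum_range_succ]
      have h2 := l1_sub_le (x (k + 1)) (z (S (k + 1))) (x k)
      have h3 := pow_le_pow_left₀ (l1_nonneg _) h2 2
      have h4 := mul_le_mul_of_nonneg_left h3 (show 0 ≤ μ / 12 by positivity)
      -- The slack in `(p + q)²/12 ≤ p²/4 + q²/8`, the optimal combination of the two half-steps
      -- through the leader.
      have h5 : 0 ≤ μ / 24 *
        (l1 (z (S (k + 1)) - x k) - 2 * l1 (x (k + 1) - z (S (k + 1)))) ^ 2 := by positivity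
      simp only [hV] at ih ⊢
      linarith
  obtain ⟨k, rfl⟩ : ∃ k, T = k + 1 := ⟨T - 1, by omega⟩
  rw [Nat.add_sub_cancel]
  set A := ∑ s ∈ Finset.range k, ‖ν (s + 1) - ν s‖ ^ 2 with hA
  set B := ∑ s ∈ Finset.range k, l1 (x (s + 1) - x s) ^ 2 with hB
  have hB0 : 0 ≤ B := Finset.sum_nonneg fun _ _ => sq_nonneg _
  have hvar : ∑ s ∈ Finset.range k, ‖u (s + 1) - u s‖ ^ 2 ≤ 6 * A + 3 * B := by
    rw [hA, hB, Finset.mul_sum, Finset.mul_sum, ← Finset.sum_add_distrib]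
    refine Finset.sum_le_sum fun s hs => ?_
    have hs := Finset.mem_range.1 hs
    have h1 := norm_signal_sub_le (v := ν s) (v' := ν (s + 1)) (x := x s) (x' := x (s + 1))
      (hν s (by omega)) (hxs (s + 1) (by omega))
    refine (pow_le_pow_left₀ (norm_nonneg _) h1 2).trans ?_
    nlinarith [sq_nonneg (‖ν (s + 1) - ν s‖ - l1 (x (s + 1) - x s))]
  set E := 16 * η ^ 2 / μ + 24 * η ^ 2 / μ * A - μ / 16 * B with hE
  have hV1 : V (k + 1) ≤ V 0 + E := by
    have h1 := key k (by omega)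
    have h2 := mul_le_mul_of_nonneg_left hvar (show 0 ≤ 4 * η ^ 2 / μ by positivity)
    have h3 : 0 ≤ μ / 8 * l1 (z (S (k + 1)) - x k) ^ 2 := by positivity
    -- The path length entering through the signals uses up `μ/48` of `μ/12`, which leaves the
    -- coefficient `μ/16`.
    have h4 : 12 * η ^ 2 / μ ≤ μ / 48 := by
      rw [div_le_div_iff₀ hμ (by norm_num)]
      nlinarith [h.rate_sq_le]
    have h5 := mul_le_mul_of_nonneg_right h4 hB0
    have e1 : 4 * η ^ 2 / μ * (6 * A + 3 * B) = 24 * η ^ 2 / μ * A + 12 * η ^ 2 / μ * B := by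
      ring
    have e2 : 4 * η ^ 2 / μ * 4 = 16 * η ^ 2 / μ := by ring
    rw [mul_add] at h1
    rw [e1] at h2
    linarith
  have hcmp : ∀ v ∈ stdSimplex ℝ (Fin d), ∀ l ∈ Set.Ioc 0 η, ∃ v' ∈ D,
      l1 (v - v') ≤ 2 / (k + 1 : ℕ) ∧
      α * Real.log l + l * dotProduct (S (k + 1)) v' ≤ α * Real.log η + R (k + 1) + E := by
    intro v hv l hl
    obtain ⟨v', hv', hR, hl1⟩ := h.comparator (k + 1) hT v hv
    refine ⟨v', hv', hl1, ?_⟩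
    have h1 := ((isStep_iff h.reg).1 (hz (S (k + 1)))).2.2 l hl v' hv'
    have h2 : V 0 ≤ α * Real.log η - ψ (z (S 0)) := by
      have h0 := hz (S 0)
      have := mul_le_mul_of_nonneg_left (Real.log_le_log h0.1.1.1 h0.1.1.2) hα.le
      have e : S 0 = 0 := by simp [hS]
      simp only [hV, objective]
      rw [show dotProduct (S 0) (z (S 0)) = 0 by rw [e, zero_dotProduct], mul_zero]
      linarith
    have h3 := hR (z (S 0)) (hz (S 0)).2.1
    have h4 : objective ψ α (S (k + 1)) (lz (S (k + 1))) (z (S (k + 1))) ≤ V 0 + E := hV1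
    unfold objective at h1 h4
    linarith
  have hT0 : (0 : ℝ) < (k + 1 : ℕ) := by positivity
  have hlogT : 0 ≤ α * Real.log (k + 1 : ℕ) :=
    mul_nonneg hα.le (Real.log_nonneg (by exact_mod_cast hT))
  have hfin : η * w ≤ 2 * η + α * Real.log (k + 1 : ℕ) + R (k + 1) + E := by
    -- For `w = 0` the comparator rate is `η/T`: it costs `α log T`, but shrinks the linear term, at
    -- worst `-2T`, to `-2η`. For genuine regret the rate is `η`, and replacing the comparator by
    -- one in `D` costs `2/T` per round.
    rcases hw with rfl | ⟨v, hv, rfl⟩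
    · obtain ⟨v, hv⟩ := stdSimplex_nonempty h.two_le
      obtain ⟨v', hv', -, h1⟩ := hcmp v hv (η / (k + 1 : ℕ))
        ⟨by positivity, div_le_self hη.le (by exact_mod_cast hT)⟩
      rw [Real.log_div hη.ne' hT0.ne'] at h1
      have h2 : -(2 * ((k + 1 : ℕ) : ℝ)) ≤ dotProduct (S (k + 1)) v' := by
        rw [hS]
        simp only
        rw [← sum_dotProduct']
        have : ∑ t ∈ Finset.range (k + 1), (-2 : ℝ) ≤
            ∑ t ∈ Finset.range (k + 1), dotProduct (u t) v' := by
          refine Finset.sum_le_sum fun t ht => ?_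
          have := hun t (Finset.mem_range.1 ht)
          have := abs_le.1 (abs_dotProduct_le_norm (v := u t) (h.reg.subset_simplex hv'))
          linarith
        rw [Finset.sum_const, Finset.card_range, nsmul_eq_mul] at this
        linarith
      have h3 := mul_le_mul_of_nonneg_left h2 (show 0 ≤ η / (k + 1 : ℕ) by positivity)
      have e : η / (k + 1 : ℕ) * -(2 * ((k + 1 : ℕ) : ℝ)) = -(2 * η) := by field_simp
      rw [e] at h3
      linarith
    · obtain ⟨v', hv', hl1, h1⟩ := hcmp v hv η ⟨hη, le_rfl⟩
      have hv's := h.reg.subset_simplex hv'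
      have h2 : ∑ t ∈ Finset.range (k + 1), dotProduct (ν t) v -
          ∑ t ∈ Finset.range (k + 1), dotProduct (ν t) (x t) ≤
          dotProduct (S (k + 1)) v' + 2 := by
        rw [hS]
        simp only
        rw [← sum_dotProduct', ← Finset.sum_sub_distrib]
        have : ∑ t ∈ Finset.range (k + 1), (dotProduct (ν t) v - dotProduct (ν t) (x t)) ≤
            ∑ t ∈ Finset.range (k + 1), (dotProduct (u t) v' + 2 / (k + 1 : ℕ)) := by
          refine Finset.sum_le_sum fun t ht => ?_
          rw [hu]
          simp only
          rw [signal_dotProduct hv's]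
          have a1 := dotProduct_le_norm_mul (ν t) (v - v')
          have a2 := mul_le_of_le_one_left (l1_nonneg (v - v')) (hν t (Finset.mem_range.1 ht))
          rw [dotProduct_sub] at a1
          linarith
        rw [Finset.sum_add_distrib, Finset.sum_const, Finset.card_range, nsmul_eq_mul,
          mul_div_cancel₀ _ hT0.ne'] at this
        exact this
      have h3 := mul_le_mul_of_nonneg_left h2 hη.le
      linarith
  have h16 : 16 * η ^ 2 / μ ≤ η := by
    rw [div_le_iff₀ hμ]
    nlinarith [h.rate_mul_le]
  have hfin2 : η * w ≤ η * (3 + (α * Real.log (k + 1 : ℕ) + R (k + 1)) / η + 24 * η / μ * A -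
      μ / (16 * η) * B) := by
    have e : η * (3 + (α * Real.log (k + 1 : ℕ) + R (k + 1)) / η + 24 * η / μ * A -
      μ / (16 * η) * B) = 3 * η + α * Real.log (k + 1 : ℕ) + R (k + 1) + 24 * η ^ 2 / μ * A -
        μ / 16 * B := by
      field_simp
      ring
    rw [e]
    linarith
  exact le_of_mul_le_mul_left hfin2 hη

end IsAdmissible

lemma regret_le (hd : 2 ≤ d) {ν x : ℕ → Fin d → ℝ} {T : ℕ} {B : ℝ}
    (h : ∀ z ∈ stdSimplex ℝ (Fin d), ∑ t ∈ Finset.range T, dotProduct (ν t) z -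
      ∑ t ∈ Finset.range T, dotProduct (ν t) (x t) ≤ B) : regret ν x T ≤ B := by
  unfold regret
  rw [sub_le_iff_le_add]
  refine csSup_le ((stdSimplex_nonempty hd).image _) ?_
  rintro _ ⟨z, hz, rfl⟩
  have := h z hz
  simp only
  linarith

namespace IsAdmissible

variable {D : Set (Fin d → ℝ)} {ψ : (Fin d → ℝ) → ℝ} {γ : ℝ → ℝ} {n : ℕ} {L μ α η : ℝ}
  {R : ℕ → ℝ}

lemma bound_nonneg (h : IsAdmissible D ψ γ n L μ α η R) {T : ℕ} (hT : 1 ≤ T) :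
    0 ≤ (α * Real.log T + R T) / η := by
  have h1 : 0 ≤ Real.log T := Real.log_nonneg (by exact_mod_cast hT)
  have := h.alpha_pos
  have := h.rate_pos
  have := h.range_nonneg hT
  positivity

/-- Without an alarm the regret is polylogarithmic. -/
lemma regret_le_of_not_alarm (h : IsAdmissible D ψ γ n L μ α η R) {ν x : ℕ → Fin d → ℝ} {T : ℕ}
    (hT : 1 ≤ T) (hν : ∀ t < T, ‖ν t‖ ≤ 1) (hstep : ∀ t < T, StepAt D ψ α η ν x t)
    (hal : ¬ Alarm n L μ α η R ν T) {z : Fin d → ℝ} (hz : z ∈ stdSimplex ℝ (Fin d)) :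
    ∑ t ∈ Finset.range T, dotProduct (ν t) z - ∑ t ∈ Finset.range T, dotProduct (ν t) (x t) ≤
      6 + 2 * (α * Real.log T + R T) / η := by
  have hμ := h.mu_pos
  have hη := h.rate_pos
  have h1 := h.regret_le_variation hT hν hstep (Or.inr ⟨z, hz, rfl⟩)
  have h2 := not_lt.1 fun hlt => hal ⟨hT, hlt⟩
  have h3 := mul_le_mul_of_nonneg_left h2 (show 0 ≤ 24 * η / μ by positivity)
  have h4 : 0 ≤ μ / (16 * η) * ∑ s ∈ Finset.range (T - 1), l1 (x (s + 1) - x s) ^ 2 :=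
    mul_nonneg (by positivity) (Finset.sum_nonneg fun _ _ => sq_nonneg _)
  have hb := h.bound_nonneg hT
  set b := (α * Real.log T + R T) / η with hbdef
  -- Here `3072 = 24 · 128` is half of `6144 = (32√6)²` from the rate cap.
  have h5 : 24 * η / μ * (L ^ 2 * (n : ℝ) ^ 2 * (128 * η / μ) * (3 + b)) ≤ 3 + b := by
    have e : 24 * η / μ * (L ^ 2 * (n : ℝ) ^ 2 * (128 * η / μ) * (3 + b)) =
        (3072 * η ^ 2 * (L ^ 2 * (n : ℝ) ^ 2) / μ ^ 2) * (3 + b) := by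
      field_simp
      ring
    rw [e]
    refine mul_le_of_le_one_left (by linarith) ?_
    rw [div_le_one (by positivity)]
    nlinarith [h.rate_sq_smoothness_le]
  have e : 2 * (α * Real.log T + R T) / η = 2 * b := by rw [hbdef]; ring
  rw [e]
  linarith

/-! ### Self-play -/

/-- The `w = 0` case of `regret_le_variation`, summed over all players, bounds the total squared
path length `M`; smoothness turns this into a bound on the variation. Only plays before round `T`
enter, as the induction in `adaptiveIsCOFTRL` requires. -/
lemma not_alarm_of_selfPlay (h : IsAdmissible D ψ γ n L μ α η R) {U : Fin n → (Fin n → Fin d) → ℝ}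
    (hU : IsBoundedSmooth L U) {x : ℕ → Fin n → Fin d → ℝ} {T : ℕ} (hT : 1 ≤ T)
    (hstep : ∀ i, ∀ t < T, StepAt D ψ α η (fun t => reward U i (x t)) (fun t => x t i) t)
    (i : Fin n) : ¬ Alarm n L μ α η R (fun t => reward U i (x t)) T := by
  rintro ⟨-, hlt⟩
  refine absurd hlt (not_lt.2 ?_)
  have hμ := h.mu_pos
  have hη := h.rate_pos
  have hL := h.smoothness_pos
  have hxs : ∀ t < T, ∀ j, x t j ∈ stdSimplex ℝ (Fin d) := fun t ht j => by
    obtain ⟨l, hl⟩ := hstep j t ht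
    exact h.reg.subset_simplex hl.2.1
  have hν : ∀ j, ∀ t < T, ‖reward U j (x t)‖ ≤ 1 := fun j t ht =>
    (pi_norm_le_iff_of_nonneg zero_le_one).2 fun k => abs_reward_le hU j (hxs t ht) k
  set M : ℝ := ∑ j, ∑ s ∈ Finset.range (T - 1), l1 (x (s + 1) j - x s j) ^ 2 with hM
  have hM0 : 0 ≤ M := Finset.sum_nonneg fun _ _ => Finset.sum_nonneg fun _ _ => sq_nonneg _
  have hvar : ∀ j, ∑ s ∈ Finset.range (T - 1), ‖reward U j (x (s + 1)) - reward U j (x s)‖ ^ 2 ≤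
      L ^ 2 * n * M := by
    intro j
    rw [hM, Finset.sum_comm, Finset.mul_sum]
    refine Finset.sum_le_sum fun s hs => ?_
    have hs := Finset.mem_range.1 hs
    have h1 := hU.smooth j (x (s + 1)) (x s) (hxs _ (by omega)) (hxs _ (by omega))
    have h2 := pow_le_pow_left₀ (norm_nonneg _) h1 2
    have h3 := sq_sum_le_card_mul_sum_sq (s := Finset.univ)
      (f := fun j => l1 (x (s + 1) j - x s j))
    rw [Finset.card_univ, Fintype.card_fin] at h3
    have h4 := mul_le_mul_of_nonneg_left h3 (sq_nonneg L)
    rw [mul_pow] at h2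
    linarith
  set b := (α * Real.log T + R T) / η with hb
  have hsum : 0 ≤ n * (3 + b) + 24 * η / μ * (L ^ 2 * n ^ 2 * M) - μ / (16 * η) * M := by
    have h1 : ∀ j, 0 ≤ 3 + b + 24 * η / μ * (L ^ 2 * n * M) -
        μ / (16 * η) * ∑ s ∈ Finset.range (T - 1), l1 (x (s + 1) j - x s j) ^ 2 := by
      intro j
      have a1 := h.regret_le_variation hT (hν j) (hstep j) (Or.inl rfl)
      have a2 := mul_le_mul_of_nonneg_left (hvar j) (show 0 ≤ 24 * η / μ by positivity)
      linarith
    have h2 := Finset.sum_nonneg fun j (_ : j ∈ Finset.univ) => h1 j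
    rw [Finset.sum_sub_distrib, ← Finset.mul_sum, ← hM, Finset.sum_const, Finset.card_univ,
      Fintype.card_fin, nsmul_eq_mul] at h2
    refine h2.trans (le_of_eq ?_)
    ring
  -- This is where the `Ln` part of the rate cap is used in full: the positive term is at most a
  -- sixteenth of the negative one.
  have hc : 24 * η / μ * (L ^ 2 * n ^ 2 * M) ≤ μ / (256 * η) * M := by
    have e : 24 * η / μ * (L ^ 2 * n ^ 2 * M) = 24 * η * (L ^ 2 * n ^ 2) / μ * M := by ring
    rw [e]
    refine mul_le_mul_of_nonneg_right ?_ hM0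
    rw [div_le_div_iff₀ hμ (by positivity)]
    nlinarith [h.rate_sq_smoothness_le]
  have hMle : M ≤ 128 * η / μ * (n * (3 + b)) := by
    have e : M = 128 * η / μ * (μ / (128 * η) * M) := by field_simp
    rw [e]
    refine mul_le_mul_of_nonneg_left ?_ (by positivity)
    have e1 : μ / (16 * η) * M = 16 * (μ / (256 * η) * M) := by field_simp; ring
    have e2 : μ / (128 * η) * M = 2 * (μ / (256 * η) * M) := by field_simp; ring
    have : 0 ≤ μ / (256 * η) * M := by positivity
    linarith
  refine (hvar i).trans ?_
  have := mul_le_mul_of_nonneg_left hMle (show 0 ≤ L ^ 2 * (n : ℝ) by positivity)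
  refine this.trans (le_of_eq ?_)
  ring

theorem selfPlayRegretLE (h : IsAdmissible D ψ γ n L μ α η R) {T : ℕ} (hT : 1 ≤ T) :
    SelfPlayRegretLE D ψ n L α η T (6 + 2 * (α * Real.log T + R T) / η) := by
  intro U hU x hx i
  have hxs : ∀ t j, x t j ∈ stdSimplex ℝ (Fin d) := fun t j => by
    obtain ⟨l, hl⟩ := hx j t
    exact h.reg.subset_simplex hl.2.1
  refine regret_le h.two_le fun z hz => ?_
  exact h.regret_le_of_not_alarm (ν := fun t => reward U i (x t)) (x := fun t => x t i) hT
    (fun t _ => (pi_norm_le_iff_of_nonneg zero_le_one).2 fun k => abs_reward_le hU i (hxs t) k)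
    (fun t _ => hx i t) (h.not_alarm_of_selfPlay hU hT (fun j t _ => hx j t) i) hz

theorem adaptiveIsCOFTRL (h : IsAdmissible D ψ γ n L μ α η R) :
    AdaptiveIsCOFTRL D ψ n L μ α η R := by
  intro U hU x hx
  have key : ∀ m, ∀ i, ¬ Alarm n L μ α η R (fun t => reward U i (x t)) m := by
    intro m
    induction m using Nat.strong_induction_on with
    | _ m ih =>
      intro i hal
      -- The induction is over all players at once: without an alarm before `m`, everybody has
      -- played COFTRL in all rounds the alarm at `m` depends on.
      refine h.not_alarm_of_selfPlay hU hal.1 (fun j t ht => (hx j t).1 fun m' hm' => ?_) i hal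
      exact ih m' (by omega) j
  exact fun i t => (hx i t).1 fun m _ => key m i

/-! ### Adversarial rewards -/

theorem adversarialRegretLE (h : IsAdmissible D ψ γ n L μ α η R) {T : ℕ} (hT : 1 ≤ T) :
    AdversarialRegretLE D ψ n L μ α η R T
      (8 + 2 * (α * Real.log T + R T) / η + 4 * √(T * Real.log d)) := by
  classical
  intro ν x hν hx
  have hνn : ∀ t, ‖ν t‖ ≤ 1 := fun t => (pi_norm_le_iff_of_nonneg zero_le_one).2 (hν t)
  refine regret_le h.two_le fun z hz => ?_
  have hsq : 0 ≤ √(T * Real.log d) := Real.sqrt_nonneg _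
  by_cases hex : ∃ m ≤ T, Alarm n L μ α η R ν m
  · obtain ⟨m', hm'T, hm'⟩ := hex
    have hex' : ∃ m, Alarm n L μ α η R ν m := ⟨m', hm'⟩
    set m := Nat.find hex' with hm
    have hal : Alarm n L μ α η R ν m := Nat.find_spec hex'
    have hmin : ∀ k < m, ¬ Alarm n L μ α η R ν k := fun k hk => Nat.find_min hex' hk
    have hmT : m ≤ T := (Nat.find_min' hex' hm').trans hm'T
    have hleast : IsLeast {m | Alarm n L μ α η R ν m} m :=
      ⟨hal, fun k hk => Nat.find_min' hex' hk⟩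
    -- A single reward has no variation, so the alarm cannot ring at 1, and at least one alarm-free
    -- round precedes it.
    have hm2 : 2 ≤ m := by
      by_contra hlt
      have hm1 : m = 1 := by have := hal.1; omega
      have h1 := hal.2
      rw [hm1] at h1
      have h2 := h.bound_nonneg (le_refl 1)
      have := h.mu_pos
      have := h.rate_pos
      have h3 : 0 ≤ L ^ 2 * (n : ℝ) ^ 2 * (128 * η / μ) *
          (3 + (α * Real.log (1 : ℕ) + R 1) / η) := by positivity
      simp only [Nat.sub_self, Finset.range_zero, Finset.sum_empty] at h1
      linarith
    obtain ⟨k, hk⟩ : ∃ k, m = k + 1 := ⟨m - 1, by omega⟩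
    have hk1 : 1 ≤ k := by omega
    have hsteps : ∀ t < m, StepAt D ψ α η ν x t := fun t ht =>
      (hx t).1 fun k hk => hmin k (by omega)
    have h1 := h.regret_le_of_not_alarm hk1 (fun t _ => hνn t) (fun t ht => hsteps t (by omega))
      (hmin k (by omega)) hz
    -- Round `k` is still COFTRL but its reward triggers the alarm; it is charged separately at cost
    -- 2.
    obtain ⟨l, hl⟩ := hsteps k (by omega)
    have h2 := (abs_le.1 (sub_mem_abs_le (hνn k) (h.reg.subset_simplex hl.2.1) hz)).2
    have h3 := mwu_regret_le h.two_le (ν := fun s => ν (m + s)) (fun s => hν (m + s)) hz (T - m)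
    have h4 : ∀ s, x (m + s) = mwu (fun s => ν (m + s)) s := fun s => by
      have := (hx (m + s)).2 m (by omega) hleast
      rwa [Nat.add_sub_cancel_left] at this
    have hsplit : ∀ f : ℕ → ℝ, ∑ t ∈ Finset.range T, f t =
        ∑ t ∈ Finset.range k, f t + f k + ∑ s ∈ Finset.range (T - m), f (m + s) := by
      intro f
      conv_lhs => rw [show T = m + (T - m) by omega]
      rw [Finset.sum_range_add, hk, Finset.sum_range_succ]
    rw [hsplit, hsplit]
    simp only [h4]
    have h5 : √((T - m : ℕ) * Real.log d) ≤ √(T * Real.log d) := by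
      refine Real.sqrt_le_sqrt (mul_le_mul_of_nonneg_right ?_ (Real.log_natCast_nonneg d))
      exact_mod_cast Nat.sub_le T m
    have h6 : 2 * (α * Real.log k + R k) / η ≤ 2 * (α * Real.log T + R T) / η := by
      have := h.rate_pos
      have := h.alpha_pos
      have a1 := h.mono k T hk1 (by omega)
      have a2 : Real.log k ≤ Real.log T :=
        Real.log_le_log (by exact_mod_cast hk1) (by exact_mod_cast (by omega : k ≤ T))
      gcongr
    linarith
  · have h1 := h.regret_le_of_not_alarm hT (fun t _ => hνn t)
      (fun t ht => (hx t).1 fun m hm hal => hex ⟨m, by omega, hal⟩)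
      (fun hal => hex ⟨T, le_rfl, hal⟩) hz
    linarith

end IsAdmissible

/-! ### The log regularizer -/

/-- `u - 1 - log u`, the one-dimensional Itakura–Saito divergence. -/
noncomputable def logGap (u : ℝ) : ℝ := u - 1 - Real.log u

lemma logGap_nonneg {u : ℝ} (hu : 0 < u) : 0 ≤ logGap u := by
  have := Real.log_le_sub_one_of_pos hu
  unfold logGap
  linarith

lemma logReg_sub {z w : Fin d → ℝ} (hz : ∀ k, 0 < z k) (hw : ∀ k, 0 < w k) :
    logReg z - logReg w - (-∑ k, (z k - w k) / w k) = ∑ k, logGap (z k / w k) := by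
  unfold logReg
  rw [sub_neg_eq_add, sub_neg_eq_add, neg_add_eq_sub, ← Finset.sum_sub_distrib,
    ← Finset.sum_add_distrib]
  refine Finset.sum_congr rfl fun k _ => ?_
  have := (hw k).ne'
  rw [logGap, Real.log_div (hz k).ne' this, sub_div, div_self this]
  ring

lemma le_one_of_mem_stdSimplex {x : Fin d → ℝ} (hx : x ∈ stdSimplex ℝ (Fin d)) (k : Fin d) :
    x k ≤ 1 := by
  rw [← hx.2]
  exact Finset.single_le_sum (fun j _ => hx.1 j) (Finset.mem_univ k)

/-- Cauchy–Schwarz with weights `w k`, which sum to 1. The coordinatewise bound works because `w k *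
max 1 (z k / w k)` is the larger of two probabilities. -/
lemma l1_sq_le_logGap {z w : Fin d → ℝ} (hz : z ∈ openSimplex d) (hw : w ∈ openSimplex d) :
    l1 (z - w) ^ 2 ≤ 2 * ∑ k, logGap (z k / w k) := by
  have h := Finset.sum_sq_le_sum_mul_sum_of_sq_le_mul Finset.univ
    (r := fun k => |z k - w k|) (f := fun k => w k) (g := fun k => 2 * logGap (z k / w k))
    (fun k _ => (hw.2 k).le)
    (fun k _ => mul_nonneg (by norm_num) (logGap_nonneg (div_pos (hz.2 k) (hw.2 k))))
    (fun k _ => by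
      have hwk := hw.2 k
      have h1 := sq_le_mul_sub_log (div_pos (hz.2 k) hwk)
      have h2 : w k * max 1 (z k / w k) ≤ 1 := by
        rw [mul_max_of_nonneg _ _ hwk.le, mul_one, mul_div_cancel₀ _ hwk.ne']
        exact max_le (le_one_of_mem_stdSimplex hw.1 k) (le_one_of_mem_stdSimplex hz.1 k)
      have h3 := logGap_nonneg (div_pos (hz.2 k) hwk)
      have e : z k - w k = w k * (z k / w k - 1) := by field_simp
      rw [sq_abs, e, mul_pow]
      calc w k ^ 2 * (z k / w k - 1) ^ 2
          ≤ w k ^ 2 * (2 * max 1 (z k / w k) * logGap (z k / w k)) :=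
            mul_le_mul_of_nonneg_left h1 (sq_nonneg _)
        _ = (w k * max 1 (z k / w k)) * (w k * (2 * logGap (z k / w k))) := by ring
        _ ≤ 1 * (w k * (2 * logGap (z k / w k))) := by gcongr
        _ = _ := one_mul _)
  rw [hw.1.2, one_mul, ← Finset.mul_sum] at h
  exact h

lemma convex_openSimplex : Convex ℝ (openSimplex d) := by
  intro x hx y hy a b ha hb hab
  refine ⟨convex_stdSimplex ℝ (Fin d) hx.1 hy.1 ha hb hab, fun k => ?_⟩
  have h1 := hx.2 k
  have h2 := hy.2 k
  simp only [Pi.add_apply, Pi.smul_apply, smul_eq_mul]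
  rcases ha.eq_or_lt with rfl | ha'
  · rw [zero_add] at hab
    rw [hab]; linarith
  · have := mul_pos ha' h1
    have := mul_nonneg hb h2.le
    linarith

lemma logReg_stronglyConvex : IsStronglyConvexL1 (openSimplex d) logReg 1 := by
  intro x hx y hy a b ha hb hab
  have hm := convex_openSimplex hx hy ha hb hab
  set m := a • x + b • y with hmdef
  have h1 := l1_sq_le_logGap hx hm
  have h2 := l1_sq_le_logGap hy hm
  rw [← logReg_sub hx.2 hm.2] at h1
  rw [← logReg_sub hy.2 hm.2] at h2
  have e1 : x - m = b • (x - y) := by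
    have : a = 1 - b := by linarith
    rw [hmdef, this, sub_smul, one_smul, smul_sub]; abel
  have e2 : y - m = a • (y - x) := by
    have : b = 1 - a := by linarith
    rw [hmdef, this, sub_smul, one_smul, smul_sub]; abel
  rw [e1, l1_smul, mul_pow, sq_abs] at h1
  rw [e2, l1_smul, mul_pow, sq_abs, l1_sub_comm] at h2
  -- The first-order terms at `m` cancel in the convex combination, so only the two divergences from
  -- `m` remain.
  have h3 : a * ∑ k, (x k - m k) / m k + b * ∑ k, (y k - m k) / m k = 0 := by
    rw [Finset.mul_sum, Finset.mul_sum, ← Finset.sum_add_distrib]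
    refine Finset.sum_eq_zero fun k _ => ?_
    have : a * (x k - m k) + b * (y k - m k) = 0 := by
      have hk : m k = a * x k + b * y k := by simp [hmdef]
      have : a * (x k - m k) + b * (y k - m k) = a * x k + b * y k - (a + b) * m k := by ring
      rw [this, hab, hk]; ring
    rw [← mul_div_assoc, ← mul_div_assoc, ← add_div, this, zero_div]
  have h4 := mul_le_mul_of_nonneg_left h1 ha
  have h5 := mul_le_mul_of_nonneg_left h2 hb
  have e3 : a * (b ^ 2 * l1 (x - y) ^ 2) + b * (a ^ 2 * l1 (x - y) ^ 2) =
      (a * b) * l1 (x - y) ^ 2 := by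
    have : a * (b ^ 2 * l1 (x - y) ^ 2) + b * (a ^ 2 * l1 (x - y) ^ 2) =
      (a + b) * ((a * b) * l1 (x - y) ^ 2) := by ring
    rw [this, hab, one_mul]
  have e4 : a * logReg m + b * logReg m = logReg m := by rw [← add_mul, hab, one_mul]
  linarith

lemma isRegularizer_logReg : IsRegularizer (openSimplex d) logReg where
  subset_simplex _ hx := hx.1
  interior_subset _ hx h := ⟨hx, h⟩
  convexOn := by
    refine ⟨convex_openSimplex, fun x hx y hy a b ha hb hab => ?_⟩
    have h := logReg_stronglyConvex x hx y hy a b ha hb hab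
    have : 0 ≤ 1 / 2 * (a * b) * l1 (x - y) ^ 2 := by positivity
    simp only [smul_eq_mul]
    linarith
  closed c := by
    -- All terms `-log (x k)` are nonnegative on the simplex, so a sublevel set keeps every
    -- coordinate above `exp (-c)`, where the logarithm is continuous.
    set K : Set (Fin d → ℝ) :=
      stdSimplex ℝ (Fin d) ∩ ⋂ k : Fin d, {x : Fin d → ℝ | Real.exp (-c) ≤ x k} with hK
    have hKc : IsClosed K := (isClosed_stdSimplex ℝ (Fin d)).inter
      (isClosed_iInter fun k => isClosed_le continuous_const (continuous_apply k))
    have hpos : ∀ x ∈ K, ∀ k, 0 < x k := fun x hx k =>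
      (Real.exp_pos _).trans_le (Set.mem_iInter.1 hx.2 k)
    have hcont : ContinuousOn logReg K := by
      unfold logReg
      refine (continuousOn_finsetSum _ fun k _ => ?_).neg
      exact ContinuousOn.log (continuous_apply k).continuousOn fun x hx => (hpos x hx k).ne'
    have e : {x | x ∈ openSimplex d ∧ logReg x ≤ c} = K ∩ logReg ⁻¹' Set.Iic c := by
      ext x
      constructor
      · rintro ⟨hx, hc⟩
        refine ⟨⟨hx.1, Set.mem_iInter.2 fun k => ?_⟩, hc⟩
        have h1 : -Real.log (x k) ≤ logReg x := by
          unfold logReg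
          rw [← Finset.sum_neg_distrib]
          refine Finset.single_le_sum (f := fun k => -Real.log (x k)) (fun j _ => ?_)
            (Finset.mem_univ k)
          have := Real.log_nonpos (hx.1.1 j) (le_one_of_mem_stdSimplex hx.1 j)
          linarith
        rw [Set.mem_ofPred_eq, ← Real.le_log_iff_exp_le (hx.2 k)]
        linarith
      · rintro ⟨hx, hc⟩
        exact ⟨⟨hx.1, hpos x hx⟩, hc⟩
    rw [e]
    exact hcont.preimage_isClosed_of_isClosed hKc isClosed_Iic

/-! ### Divergences of the log regularizer and its local intrinsic Lipschitz property -/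

lemma bregman_eq_of_hasDerivAt {f : (Fin d → ℝ) → ℝ} {z w : Fin d → ℝ} {p : ℝ}
    (h : HasDerivAt (fun t : ℝ => f (w + t • (z - w))) p 0) :
    bregman f z w = ((f z - f w - p : ℝ) : EReal) := by
  have h1 := (hasDerivAt_iff_tendsto_slope_zero.1 h).mono_left
    (nhdsWithin_mono 0 fun t (ht : 0 < t) => ht.ne')
  have h2 : Tendsto (fun t : ℝ => (((f (w + t • (z - w)) - f w) / t : ℝ) : EReal)) (𝓝[>] 0)
      (𝓝 (p : EReal)) := by
    refine (continuous_coe_real_ereal.tendsto p).comp (h1.congr fun t => ?_)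
    simp [div_eq_inv_mul]
  unfold bregman
  rw [h2.liminf_eq, EReal.coe_sub (f z - f w) p]

lemma hasDerivAt_logReg {z w : Fin d → ℝ} (hw : ∀ k, 0 < w k) :
    HasDerivAt (fun t : ℝ => logReg (w + t • (z - w))) (-∑ k, (z k - w k) / w k) 0 := by
  unfold logReg
  refine HasDerivAt.neg (HasDerivAt.fun_sum fun k _ => ?_)
  have h1 : HasDerivAt (fun t : ℝ => (w + t • (z - w)) k) (z k - w k) 0 := by
    simpa using ((hasDerivAt_id (0 : ℝ)).mul_const (z k - w k)).const_add (w k)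
  have h2 := h1.log (by simpa using (hw k).ne')
  simpa using h2

lemma bregman_logReg {z w : Fin d → ℝ} (hz : ∀ k, 0 < z k) (hw : ∀ k, 0 < w k) :
    bregman logReg z w = ((∑ k, logGap (z k / w k) : ℝ) : EReal) := by
  rw [bregman_eq_of_hasDerivAt (hasDerivAt_logReg hw), logReg_sub hz hw]

lemma logReg_normalize {y : Fin d → ℝ} (hy : ∀ k, 0 < y k) (hs : 0 < ∑ k, y k) :
    logReg (normalize y) = logReg y + d * Real.log (∑ k, y k) := by
  unfold logReg normalize
  have : ∀ k, Real.log (((∑ k, y k)⁻¹ • y) k) = Real.log (y k) - Real.log (∑ k, y k) := by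
    intro k
    rw [Pi.smul_apply, smul_eq_mul, Real.log_mul (inv_pos.2 hs).ne' (hy k).ne', Real.log_inv]
    ring
  simp only [this, Finset.sum_sub_distrib, Finset.sum_const, Finset.card_univ, Fintype.card_fin,
    nsmul_eq_mul]
  ring

lemma liftedReg_logReg {α : ℝ} {y : Fin d → ℝ} (hy : ∀ k, 0 < y k) (hs : 0 < ∑ k, y k) :
    liftedReg logReg α y = logReg y - (α - d) * Real.log (∑ k, y k) := by
  rw [liftedReg, logReg_normalize hy hs]
  ring

lemma bregman_liftedReg_logReg {α : ℝ} {z w : Fin d → ℝ} (hz : ∀ k, 0 < z k)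
    (hzs : 0 < ∑ k, z k) (hw : ∀ k, 0 < w k) (hws : 0 < ∑ k, w k) :
    bregman (liftedReg logReg α) z w =
      ((∑ k, logGap (z k / w k) + (α - d) * logGap ((∑ k, z k) / ∑ k, w k) : ℝ) : EReal) := by
  have hsum : HasDerivAt (fun t : ℝ => ∑ k, (w + t • (z - w)) k) (∑ k, z k - ∑ k, w k) 0 := by
    rw [← Finset.sum_sub_distrib]
    refine HasDerivAt.fun_sum fun k _ => ?_
    simpa using ((hasDerivAt_id (0 : ℝ)).mul_const (z k - w k)).const_add (w k)
  have h1 := (hasDerivAt_logReg (z := z) hw).sub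
    ((hsum.log (by simpa using hws.ne')).const_mul (α - d))
  have hcont : ∀ k, ∀ᶠ t : ℝ in 𝓝 0, 0 < (w + t • (z - w)) k := by
    intro k
    have : ContinuousAt (fun t : ℝ => (w + t • (z - w)) k) 0 := by
      simp only [Pi.add_apply, Pi.smul_apply, smul_eq_mul]
      fun_prop
    exact this.eventually (lt_mem_nhds (by simpa using hw k))
  have hev : (fun t : ℝ => liftedReg logReg α (w + t • (z - w))) =ᶠ[𝓝 0]
      ((fun t : ℝ => logReg (w + t • (z - w))) -
        fun t : ℝ => (α - d) * Real.log (∑ k, (w + t • (z - w)) k)) := by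
    have hs := hsum.continuousAt.eventually (lt_mem_nhds (show 0 < _ by simpa using hws))
    filter_upwards [eventually_all.2 hcont, hs] with t ht hts
    exact liftedReg_logReg ht hts
  rw [bregman_eq_of_hasDerivAt (h1.congr_of_eventuallyEq hev), liftedReg_logReg hz hzs,
    liftedReg_logReg hw hws, ← logReg_sub hz hw]
  congr 1
  simp only [zero_smul, add_zero]
  rw [logGap, Real.log_div hzs.ne' hws.ne', sub_div, div_self hws.ne']
  ring

lemma pos_of_mem_lifted {y : Fin d → ℝ} (hy : y ∈ lifted (openSimplex d)) (k : Fin d) :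
    0 < y k := by
  have h := hy.2.2.2 k
  rw [normalize, Pi.smul_apply, smul_eq_mul] at h
  exact pos_of_mul_pos_right h (inv_pos.2 hy.1).le

lemma logGap_add_inv (u : ℝ) : logGap u + logGap u⁻¹ = u + u⁻¹ - 2 := by
  rw [logGap, logGap, Real.log_inv]
  ring

lemma log_sq_le_logGap {u c : ℝ} (hu : 0 < u) (hc : 1 ≤ c) (huc : u⁻¹ ≤ c) :
    Real.log u ^ 2 ≤ 2 * c * logGap u := by
  refine (log_sq_le hu).trans ?_
  rw [div_le_iff₀ hu]
  refine (sq_le_mul_sub_log hu).trans ?_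
  have h1 : max 1 u ≤ c * u := by
    refine max_le ?_ (le_mul_of_one_le_left hu.le hc)
    rwa [inv_le_iff_one_le_mul₀ hu] at huc
  have h2 := mul_le_mul_of_nonneg_right h1 (logGap_nonneg hu)
  unfold logGap at h2 ⊢
  linarith

/-- The log regularizer is locally intrinsically Lipschitz. -/
lemma isLIL_logReg {α : ℝ} (hα : (d : ℝ) ≤ α) :
    IsLIL (openSimplex d) logReg α fun ε => 2 * d * (2 + ε) ^ 2 := by
  intro ε hε z hz w hw hle
  have hzk := pos_of_mem_lifted hz
  have hwk := pos_of_mem_lifted hw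
  rw [bregman_liftedReg_logReg hzk hz.1 hwk hw.1, bregman_liftedReg_logReg hwk hw.1 hzk hz.1,
    ← EReal.coe_add, EReal.coe_le_coe_iff] at hle
  rw [bregman_logReg hz.2.2.2 hw.2.2.2, ← EReal.coe_mul, EReal.coe_le_coe_iff, sq_abs]
  set Z := ∑ k, z k with hZ
  set W := ∑ k, w k with hW
  -- The symmetrized divergence is a sum of nonnegative terms `u + u⁻¹ - 2`, and `α ≥ d` makes the
  -- contribution of the total masses nonnegative too.
  have hratio : ∀ k, z k / w k + w k / z k ≤ 2 + ε := by
    intro k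
    have h1 : logGap (z k / w k) + logGap (w k / z k) ≤
        ∑ k, logGap (z k / w k) + ∑ k, logGap (w k / z k) := by
      rw [← Finset.sum_add_distrib]
      exact Finset.single_le_sum (f := fun k => logGap (z k / w k) + logGap (w k / z k))
        (fun j _ => add_nonneg (logGap_nonneg (div_pos (hzk j) (hwk j)))
          (logGap_nonneg (div_pos (hwk j) (hzk j)))) (Finset.mem_univ k)
    have h2 := logGap_add_inv (z k / w k)
    rw [inv_div] at h2
    have h3 := mul_nonneg (sub_nonneg.2 hα) (logGap_nonneg (div_pos hz.1 hw.1))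
    have h4 := mul_nonneg (sub_nonneg.2 hα) (logGap_nonneg (div_pos hw.1 hz.1))
    linarith
  have hzw : ∀ k, z k ≤ (2 + ε) * w k := fun k => by
    rw [← div_le_iff₀ (hwk k)]
    linarith [hratio k, div_pos (hwk k) (hzk k)]
  have hwz : ∀ k, w k ≤ (2 + ε) * z k := fun k => by
    rw [← div_le_iff₀ (hzk k)]
    linarith [hratio k, div_pos (hzk k) (hwk k)]
  have hZW : Z ≤ (2 + ε) * W := by
    rw [hZ, hW, Finset.mul_sum]
    exact Finset.sum_le_sum fun k _ => hzw k
  -- One factor `2 + ε` comes from the coordinate, the other from the total mass.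
  have hu : ∀ k, (normalize z k / normalize w k)⁻¹ ≤ (2 + ε) ^ 2 := by
    intro k
    have h1 := hwk k
    have h2 := hzk k
    have h3 := hz.1
    have h4 := hw.1
    simp only [normalize, Pi.smul_apply, smul_eq_mul]
    rw [inv_div, div_le_iff₀ (by positivity), inv_mul_eq_div, inv_mul_eq_div, ← mul_div_assoc,
      div_le_div_iff₀ hw.1 hz.1]
    calc w k * Z ≤ ((2 + ε) * z k) * ((2 + ε) * W) := by
          have := hwz k
          gcongr
      _ = _ := by ring
  have hΔ : logReg (normalize z) - logReg (normalize w) =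
      -∑ k, Real.log (normalize z k / normalize w k) := by
    unfold logReg
    rw [neg_sub_neg, ← Finset.sum_sub_distrib, ← Finset.sum_neg_distrib]
    refine Finset.sum_congr rfl fun k _ => ?_
    rw [Real.log_div (hz.2.2.2 k).ne' (hw.2.2.2 k).ne']
    ring
  rw [hΔ, neg_sq]
  have hcs := sq_sum_le_card_mul_sum_sq (s := Finset.univ)
    (f := fun k => Real.log (normalize z k / normalize w k))
  rw [Finset.card_univ, Fintype.card_fin] at hcs
  have hterm : ∑ k, Real.log (normalize z k / normalize w k) ^ 2 ≤
      ∑ k, 2 * (2 + ε) ^ 2 * logGap (normalize z k / normalize w k) :=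
    Finset.sum_le_sum fun k _ => log_sq_le_logGap (div_pos (hz.2.2.2 k) (hw.2.2.2 k))
      (by nlinarith) (hu k)
  rw [← Finset.mul_sum] at hterm
  have := mul_le_mul_of_nonneg_left hterm (Nat.cast_nonneg (α := ℝ) d)
  linarith

/-! ### COFTRL with the log regularizer as a lifted step -/

lemma normalize_mem_openSimplex {y : Fin d → ℝ} (hy : ∀ k, 0 < y k) (hs : 0 < ∑ k, y k) :
    normalize y ∈ openSimplex d := by
  have hpos : ∀ k, 0 < normalize y k := fun k => mul_pos (inv_pos.2 hs) (hy k)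
  refine ⟨⟨fun k => (hpos k).le, ?_⟩, hpos⟩
  simp only [normalize, Pi.smul_apply, smul_eq_mul]
  rw [← Finset.mul_sum, inv_mul_cancel₀ hs.ne']

/-- Up to the constant `α log η` the joint and the lifted objectives agree under this substitution;
normalization contributes the shift from `α` to `α - d`. -/
lemma objective_logReg {α η : ℝ} (hη : 0 < η) (r : Fin d → ℝ) {y : Fin d → ℝ}
    (hy : ∀ k, 0 < y k) (hs : 0 < ∑ k, y k) :
    objective logReg α r (η * ∑ k, y k) (normalize y) = η * dotProduct r y +
      (α - d) * Real.log (∑ k, y k) + ∑ k, Real.log (y k) + α * Real.log η := by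
  rw [objective, logReg_normalize hy hs, Real.log_mul hη.ne' hs.ne', normalize, dotProduct_smul,
    smul_eq_mul, logReg, mul_assoc, mul_inv_cancel_left₀ hs.ne']
  ring

/-- COFTRL with the log regularizer is lifted log-regularized OFTRL. -/
lemma isLiftedLogStep_iff (hd : 2 ≤ d) {α η : ℝ} (hη : 0 < η) (r : Fin d → ℝ) {y : Fin d → ℝ}
    (hy : ∀ k, 0 < y k) :
    IsLiftedLogStep α η r y ↔
      IsStep (openSimplex d) logReg α η r (η * ∑ k, y k) (normalize y) := by
  have : Nonempty (Fin d) := ⟨⟨0, by omega⟩⟩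
  have hsum : ∀ z : Fin d → ℝ, (∀ k, 0 < z k) → 0 < ∑ k, z k := fun z hz =>
    Finset.sum_pos (fun k _ => hz k) Finset.univ_nonempty
  have hs := hsum y hy
  rw [isStep_iff isRegularizer_logReg, objective_logReg hη r hy hs]
  constructor
  · rintro ⟨⟨-, h1⟩, h2⟩
    refine ⟨⟨by positivity, mul_le_of_le_one_right hη.le h1⟩, normalize_mem_openSimplex hy hs,
      fun l hl z hz => ?_⟩
    have hlη : 0 < l / η := div_pos hl.1 hη
    have hpos : ∀ k, 0 < ((l / η) • z) k := fun k => mul_pos hlη (hz.2 k)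
    have e1 := sum_smul_simplex hz.1 (l / η)
    have h3 := h2 ((l / η) • z) hpos (by rw [e1]; exact (div_le_one hη).2 hl.2)
    have h4 := objective_logReg (α := α) hη r hpos (hsum _ hpos)
    rw [normalize_smul_simplex hz.1 hlη, e1, mul_div_cancel₀ _ hη.ne'] at h4
    rw [e1] at h3
    linarith
  · rintro ⟨h1, -, h2⟩
    refine ⟨⟨hy, (mul_le_iff_le_one_right hη).1 h1.2⟩, fun z hz hz1 => ?_⟩
    have h3 := h2 (η * ∑ k, z k) ⟨mul_pos hη (hsum z hz), mul_le_of_le_one_right hη.le hz1⟩ _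
      (normalize_mem_openSimplex hz (hsum z hz))
    rw [objective_logReg hη r hz (hsum z hz)] at h3
    linarith

/-! ### Comparators for the log regularizer -/

lemma uniform_mem_openSimplex (hd : 2 ≤ d) : (fun _ => (d : ℝ)⁻¹) ∈ openSimplex d := by
  have hd' : (0 : ℝ) < d := by exact_mod_cast (by omega : 0 < d)
  exact ⟨⟨fun _ => by positivity, by simp [hd'.ne']⟩, fun _ => by positivity⟩

lemma le_logReg (hd : 2 ≤ d) {w : Fin d → ℝ} (hw : w ∈ openSimplex d) :
    d * Real.log d ≤ logReg w := by
  have hd' : (0 : ℝ) < d := by exact_mod_cast (by omega : 0 < d)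
  have hu := uniform_mem_openSimplex hd
  have h1 := logReg_sub hw.2 hu.2
  have h2 : 0 ≤ ∑ k, logGap (w k / (d : ℝ)⁻¹) :=
    Finset.sum_nonneg fun k _ => logGap_nonneg (div_pos (hw.2 k) (hu.2 k))
  have h3 : ∑ k, (w k - (d : ℝ)⁻¹) / (d : ℝ)⁻¹ = 0 := by
    rw [← Finset.sum_div, Finset.sum_sub_distrib, hw.1.2, hu.1.2, sub_self, zero_div]
  have h4 : logReg (fun _ : Fin d => (d : ℝ)⁻¹) = d * Real.log d := by
    simp [logReg, Real.log_inv]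
  rw [h3, h4] at h1
  linarith

lemma exists_comparator_logReg (hd : 2 ≤ d) {T : ℕ} (hT : 1 ≤ T) {z : Fin d → ℝ}
    (hz : z ∈ stdSimplex ℝ (Fin d)) : ∃ x ∈ openSimplex d,
    (∀ w ∈ openSimplex d, logReg x ≤ logReg w + d * Real.log T) ∧ l1 (z - x) ≤ 2 / T := by
  have hd' : (0 : ℝ) < d := by exact_mod_cast (by omega : 0 < d)
  have hT0 : (0 : ℝ) < T := by exact_mod_cast hT
  have hT1 : (T : ℝ)⁻¹ ≤ 1 := inv_le_one_of_one_le₀ (by exact_mod_cast hT)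
  set c : Fin d → ℝ := fun _ => (d : ℝ)⁻¹ with hc
  have hcs := uniform_mem_openSimplex hd
  -- Mixing in weight `1/T` of the uniform strategy keeps all entries above `1/(Td)`, so `logReg`
  -- exceeds its minimum `d log d` by at most `d log T`.
  set x : Fin d → ℝ := z + (T : ℝ)⁻¹ • (c - z) with hx
  have hxs : x ∈ stdSimplex ℝ (Fin d) :=
    (convex_stdSimplex ℝ (Fin d)).add_smul_sub_mem hz hcs.1 ⟨by positivity, hT1⟩
  have hxk : ∀ k, (T : ℝ)⁻¹ * (d : ℝ)⁻¹ ≤ x k := by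
    intro k
    have : x k = (1 - (T : ℝ)⁻¹) * z k + (T : ℝ)⁻¹ * (d : ℝ)⁻¹ := by
      simp only [hx, hc, Pi.add_apply, Pi.smul_apply, Pi.sub_apply, smul_eq_mul]
      ring
    rw [this]
    have := mul_nonneg (sub_nonneg.2 hT1) (hz.1 k)
    linarith
  have hpos : ∀ k, 0 < x k := fun k => lt_of_lt_of_le (by positivity) (hxk k)
  refine ⟨x, ⟨hxs, hpos⟩, fun w hw => ?_, ?_⟩
  · have h1 := le_logReg hd hw
    have h2 : logReg x ≤ ∑ _k : Fin d, (Real.log T + Real.log d) := by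
      unfold logReg
      rw [← Finset.sum_neg_distrib]
      refine Finset.sum_le_sum fun k _ => ?_
      have := Real.log_le_log (by positivity) (hxk k)
      rw [Real.log_mul (by positivity) (by positivity), Real.log_inv, Real.log_inv] at this
      linarith
    rw [Finset.sum_const, Finset.card_univ, Fintype.card_fin, nsmul_eq_mul] at h2
    linarith
  · have e : z - x = (T : ℝ)⁻¹ • (z - c) := by
      rw [hx, smul_sub, smul_sub]; abel
    rw [e, l1_smul, abs_of_pos (inv_pos.2 hT0), div_eq_inv_mul]
    refine mul_le_mul_of_nonneg_left ?_ (inv_pos.2 hT0).le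
    have := l1_add_le z (-c)
    rw [← sub_eq_add_neg] at this
    have h2 : l1 (-c) = l1 c := by simp [l1]
    rw [h2, l1_of_mem_stdSimplex hz, l1_of_mem_stdSimplex hcs.1] at this
    linarith

/-! ### Real-valued regularizers -/

lemma IsRegularizer.le_add_regRange {ψ : (Fin d → ℝ) → ℝ}
    (h : IsRegularizer (stdSimplex ℝ (Fin d)) ψ) {z w : Fin d → ℝ}
    (hz : z ∈ stdSimplex ℝ (Fin d)) (hw : w ∈ stdSimplex ℝ (Fin d)) :
    ψ z ≤ ψ w + regRange ψ := by
  -- Closedness does not bound `ψ` from above; Jensen's inequality at the vertices does. Without it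
  -- the real supremum would be meaningless.
  have habove : BddAbove (ψ '' stdSimplex ℝ (Fin d)) := by
    refine ⟨∑ k, |ψ (Pi.single k 1)|, ?_⟩
    rintro _ ⟨x, hx, rfl⟩
    have h1 := h.convexOn.map_sum_le (t := Finset.univ) (w := x)
      (p := fun k => (Pi.single k 1 : Fin d → ℝ)) (fun k _ => hx.1 k) hx.2
      fun k _ => single_mem_stdSimplex ℝ k
    have e : ∑ k, x k • (Pi.single k 1 : Fin d → ℝ) = x := by
      ext j
      simp [Finset.sum_apply, Pi.single_apply]
    rw [e] at h1
    refine h1.trans (Finset.sum_le_sum fun k _ => ?_)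
    rw [smul_eq_mul]
    calc x k * ψ (Pi.single k 1) ≤ x k * |ψ (Pi.single k 1)| :=
          mul_le_mul_of_nonneg_left (le_abs_self _) (hx.1 k)
      _ ≤ _ := mul_le_of_le_one_left (abs_nonneg _) (le_one_of_mem_stdSimplex hx k)
  have hbelow : BddBelow (ψ '' stdSimplex ℝ (Fin d)) := by
    obtain ⟨m, hm⟩ := h.exists_lower_bound
    refine ⟨m, ?_⟩
    rintro _ ⟨x, hx, rfl⟩
    exact hm x hx
  have h1 := le_csSup habove ⟨z, hz, rfl⟩
  have h2 := csInf_le hbelow ⟨w, hw, rfl⟩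
  unfold regRange
  linarith

lemma isAdmissible_of_real {n : ℕ} {L : ℝ} (hn : 1 ≤ n) (hd : 2 ≤ d) (hL : 0 < L)
    {ψ : (Fin d → ℝ) → ℝ} {γ : ℝ → ℝ} {μ α η : ℝ}
    (hψ : IsRegularizer (stdSimplex ℝ (Fin d)) ψ) (hμ : 0 < μ)
    (hsc : IsStronglyConvexL1 (stdSimplex ℝ (Fin d)) ψ μ)
    (hlil : IsLIL (stdSimplex ℝ (Fin d)) ψ α γ) (hα : 4 * γ 1 + μ ≤ α) (hη : 0 < η)
    (hcap : η ≤ rateCap (γ 1) μ L n) :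
    IsAdmissible (stdSimplex ℝ (Fin d)) ψ γ n L μ α η fun _ => regRange ψ where
  two_le := hd
  one_le := hn
  smoothness_pos := hL
  reg := hψ
  mu_pos := hμ
  strong := hsc
  lil := hlil
  alpha_ge := hα
  rate_pos := hη
  rate_le := hcap
  comparator T _ z hz := ⟨z, hz, fun _ hw => hψ.le_add_regRange hz hw, by
    rw [sub_self]
    simp only [l1, Pi.zero_apply, abs_zero, Finset.sum_const_zero]
    positivity⟩
  mono _ _ _ _ := le_rfl

lemma isAdmissible_logReg {n : ℕ} {L : ℝ} (hn : 1 ≤ n) (hd : 2 ≤ d) (hL : 0 < L) {α η : ℝ}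
    (hα : 4 * (18 * d) + 1 ≤ α) (hη : 0 < η) (hcap : η ≤ rateCap (18 * d) 1 L n) :
    IsAdmissible (openSimplex d) logReg (fun ε => 2 * d * (2 + ε) ^ 2) n L 1 α η
      fun m => d * Real.log m := by
  have hγ : 2 * (d : ℝ) * (2 + 1) ^ 2 = 18 * d := by ring
  have hd0 : (0 : ℝ) ≤ d := Nat.cast_nonneg d
  exact
  { two_le := hd
    one_le := hn
    smoothness_pos := hL
    reg := isRegularizer_logReg
    mu_pos := one_pos
    strong := logReg_stronglyConvex
    lil := isLIL_logReg (by linarith)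
    alpha_ge := by simpa only [hγ] using hα
    rate_pos := hη
    rate_le := by simpa only [hγ] using hcap
    comparator := fun T hT z hz => exists_comparator_logReg hd hT hz
    mono := fun m T hm hmT => mul_le_mul_of_nonneg_left
      (Real.log_le_log (by exact_mod_cast hm) (by exact_mod_cast hmT)) hd0 }

/-! ### Constants -/

lemma SelfPlayRegretLE.mono {D : Set (Fin d → ℝ)} {ψ : (Fin d → ℝ) → ℝ} {n : ℕ} {L α η : ℝ}
    {T : ℕ} {B B' : ℝ} (h : SelfPlayRegretLE D ψ n L α η T B) (hB : B ≤ B') :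
    SelfPlayRegretLE D ψ n L α η T B' :=
  fun U hU x hx i => (h U hU x hx i).trans hB

/-- Whichever entry attains the minimum, the matching entry of the maximum is `μ` divided by it. -/
lemma le_rateCap_mul {g μ L : ℝ} {n : ℕ} (hg : 0 < g) (hL : 0 < L) (hn : 1 ≤ n) (hμ : 0 < μ) :
    μ ≤ rateCap g μ L n *
      max (max (80 * μ / (3 * g)) (8 * μ)) (max (32 * √2) (L * n * 32 * √6)) := by
  have hn0 : (0 : ℝ) < n := by exact_mod_cast hn
  have key : ∀ a b M : ℝ, 0 ≤ a → a * b = μ → b ≤ M → μ ≤ a * M := fun a b M ha hab hb => by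
    rw [← hab]; exact mul_le_mul_of_nonneg_left hb ha
  unfold rateCap
  rcases min_choice (min (3 * g / 80) (1 / 8)) (min (μ / (32 * √2)) (μ / (32 * √6 * L * n)))
    with h | h <;> rw [h]
  · rcases min_choice (3 * g / 80) (1 / 8 : ℝ) with h | h <;> rw [h]
    · exact key _ (80 * μ / (3 * g)) _ (by positivity) (by field_simp)
        ((le_max_left _ _).trans (le_max_left _ _))
    · exact key _ (8 * μ) _ (by positivity) (by ring)
        ((le_max_right _ _).trans (le_max_left _ _))
  · rcases min_choice (μ / (32 * √2)) (μ / (32 * √6 * L * n)) with h | h <;> rw [h]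
    · exact key _ (32 * √2) _ (by positivity) (div_mul_cancel₀ _ (by positivity))
        ((le_max_left _ _).trans (le_max_right _ _))
    · exact key _ (L * n * 32 * √6) _ (by positivity) (by field_simp)
        ((le_max_right _ _).trans (le_max_right _ _))

lemma max_le_mul_max {g μ L : ℝ} {n : ℕ} (hL : 0 < L) (hμ : 1 ≤ μ) (hμg : μ ≤ g) :
    max (max (80 * μ / (3 * g)) (8 * μ)) (max (32 * √2) (L * n * 32 * √6)) ≤
      80 * μ * max 1 (L * n) := by
  have hm1 : 1 ≤ max 1 (L * n) := le_max_left _ _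
  have hm2 : L * n ≤ max 1 (L * n) := le_max_right _ _
  set m := max 1 (L * n)
  have hμm : m ≤ μ * m := le_mul_of_one_le_left (by linarith) hμ
  have hμm' : μ ≤ μ * m := le_mul_of_one_le_right (by linarith) hm1
  have h2 : √2 ≤ 2 := Real.sqrt_le_iff.2 ⟨by norm_num, by norm_num⟩
  have h6 : √6 ≤ 5 / 2 := Real.sqrt_le_iff.2 ⟨by norm_num, by norm_num⟩
  have hLn : 0 ≤ L * n := by positivity
  refine max_le (max_le ?_ ?_) (max_le ?_ ?_)
  · rw [div_le_iff₀ (by linarith)]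
    nlinarith
  · linarith
  · linarith
  · have := mul_le_mul_of_nonneg_left h6 (show 0 ≤ L * n * 32 by positivity)
    linarith

lemma bound_le_of_rateCap {g μ L A : ℝ} {n : ℕ} (hL : 0 < L) (hn : 1 ≤ n) (hμ : 1 ≤ μ)
    (hμg : μ ≤ g) (hA : 0 ≤ A) {η : ℝ} (hη : 0 < η) (hcap : η = rateCap g μ L n) :
    2 * A / η ≤ 160 * max 1 (L * n) * A := by
  have h1 := le_rateCap_mul (g := g) (by linarith) hL hn (show 0 < μ by linarith)
  rw [← hcap] at h1
  have h2 := mul_le_mul_of_nonneg_left (max_le_mul_max (n := n) hL hμ hμg) hη.le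
  have h3 : μ * 1 ≤ μ * (η * (80 * max 1 (L * n))) := by linarith
  have h4 := le_of_mul_le_mul_left h3 (by linarith)
  rw [div_le_iff₀ hη]
  have := mul_le_mul_of_nonneg_left h4 hA
  linarith

lemma two_thirds_le_log {T : ℕ} (hT : 2 ≤ T) : 2 / 3 ≤ Real.log T := by
  have h1 : Real.log 2 ≤ Real.log T := Real.log_le_log (by norm_num) (by exact_mod_cast hT)
  linarith [Real.log_two_gt_d9]

lemma exists_horizon (A B : ℝ) {c : ℝ} (hc : 0 < c) :
    ∃ T₀ : ℕ, ∀ T : ℕ, T₀ ≤ T → A + B * Real.log T ≤ c * √T := by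
  have h1 : (fun x : ℝ => Real.log x) =o[atTop] fun x : ℝ => √x := by
    simpa only [Real.sqrt_eq_rpow] using isLittleO_log_rpow_atTop (show (0 : ℝ) < 1 / 2 by norm_num)
  have h2 : (fun _ : ℝ => A) =o[atTop] fun x : ℝ => √x := by
    refine Asymptotics.isLittleO_const_left.2 (Or.inr ?_)
    exact tendsto_norm_atTop_atTop.comp Real.tendsto_sqrt_atTop
  have h3 := ((h2.add (h1.const_mul_left B)).comp_tendsto tendsto_natCast_atTop_atTop).def hc
  obtain ⟨T₀, hT₀⟩ := eventually_atTop.1 h3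
  refine ⟨T₀, fun T hT => ?_⟩
  have := hT₀ T hT
  simp only [Function.comp_apply, Real.norm_eq_abs, abs_of_nonneg (Real.sqrt_nonneg _)] at this
  exact (le_abs_self _).trans this

lemma IsAdmissible.exists_adversarial_horizon {D : Set (Fin d → ℝ)} {ψ : (Fin d → ℝ) → ℝ}
    {γ : ℝ → ℝ} {n : ℕ} {L μ α η : ℝ} {R : ℕ → ℝ} (h : IsAdmissible D ψ γ n L μ α η R) {a b C : ℝ}
    (hR : ∀ T : ℕ, R T ≤ a + b * Real.log T) (hC : 5 ≤ C) :
    ∃ T₀ : ℕ, ∀ T : ℕ, T₀ ≤ T →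
      AdversarialRegretLE D ψ n L μ α η R T (C * √(T * Real.log d)) := by
  have hη := h.rate_pos
  have hlog : 0 < Real.log d := Real.log_pos (by exact_mod_cast h.two_le)
  -- Everything except the Multiplicative Weight Update term is `O(log T)` and eventually below `√(T
  -- log d)`; hence `5 = 4 + 1` suffices.
  obtain ⟨T₀, hT₀⟩ := exists_horizon (8 + 2 * a / η) (2 * (α + b) / η) (Real.sqrt_pos.2 hlog)
  refine ⟨max T₀ 1, fun T hT ν x hν hx => ?_⟩
  refine (h.adversarialRegretLE ((le_max_right _ _).trans hT) ν x hν hx).trans ?_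
  have h1 := hT₀ T ((le_max_left _ _).trans hT)
  rw [mul_comm (√(Real.log d)), ← Real.sqrt_mul (Nat.cast_nonneg T)] at h1
  have h2 : 2 * (α * Real.log T + R T) / η ≤
      2 * a / η + 2 * (α + b) / η * Real.log T := by
    have e : 2 * a / η + 2 * (α + b) / η * Real.log T =
        2 * (α * Real.log T + (a + b * Real.log T)) / η := by ring
    rw [e]
    have := hR T
    gcongr
  have h3 := mul_le_mul_of_nonneg_right hC (Real.sqrt_nonneg (T * Real.log d))
  linarith

end COFTRL

/-! ### The main theorem -/

open COFTRL in
theorem mainTheorem9 :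
    ∃ C : ℝ, 0 < C ∧ ∀ n d : ℕ, 1 ≤ n → 2 ≤ d → ∀ L : ℝ, 0 < L →
      -- real-valued regularizers on the simplex
      (∀ (ψ : (Fin d → ℝ) → ℝ) (γ : ℝ → ℝ) (μ α η : ℝ),
        IsRegularizer (stdSimplex ℝ (Fin d)) ψ →
        0 < μ → IsStronglyConvexL1 (stdSimplex ℝ (Fin d)) ψ μ →
        IsLIL (stdSimplex ℝ (Fin d)) ψ α γ →
        4 * γ 1 + μ ≤ α → 0 < η → η ≤ rateCap (γ 1) μ L n →
        -- the algorithm is well defined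
        (∀ r, ∃ lam x, IsStep (stdSimplex ℝ (Fin d)) ψ α η r lam x) ∧
        -- regret in self-play
        (∀ T : ℕ, 1 ≤ T → SelfPlayRegretLE (stdSimplex ℝ (Fin d)) ψ n L α η T
          (6 + 2 * (α * Real.log T + regRange ψ) / η)) ∧
        (η = rateCap (γ 1) μ L n → ∀ T : ℕ, 1 ≤ T →
          SelfPlayRegretLE (stdSimplex ℝ (Fin d)) ψ n L α η T
            (6 + 2 * ((α * Real.log T + regRange ψ) / μ) *
              max (max (80 * μ / (3 * γ 1)) (8 * μ)) (max (32 * √2) (L * n * 32 * √6)))) ∧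
        (η = rateCap (γ 1) μ L n → α = 4 * γ 1 + μ → 1 ≤ μ → μ ≤ γ 1 → ∀ T : ℕ, 2 ≤ T →
          SelfPlayRegretLE (stdSimplex ℝ (Fin d)) ψ n L α η T
            (C * max 1 (L * n) * (γ 1 * Real.log T + regRange ψ)) ∧
          (regRange ψ ≤ γ 1 * Real.log T →
            SelfPlayRegretLE (stdSimplex ℝ (Fin d)) ψ n L α η T
              (C * max 1 (L * n) * γ 1 * Real.log T))) ∧
        -- adaptivity to adversarial utilities
        AdaptiveIsCOFTRL (stdSimplex ℝ (Fin d)) ψ n L μ α η (fun _ => regRange ψ) ∧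
        (∀ T : ℕ, 1 ≤ T →
          AdversarialRegretLE (stdSimplex ℝ (Fin d)) ψ n L μ α η (fun _ => regRange ψ) T
            (8 + 2 * (α * Real.log T + regRange ψ) / η + 4 * √(T * Real.log d))) ∧
        (∃ T₀ : ℕ, ∀ T : ℕ, T₀ ≤ T →
          AdversarialRegretLE (stdSimplex ℝ (Fin d)) ψ n L μ α η (fun _ => regRange ψ) T
            (C * √(T * Real.log d)))) ∧
      -- the log regularizer
      (IsRegularizer (openSimplex d) logReg ∧ IsStronglyConvexL1 (openSimplex d) logReg 1 ∧
        (∃ γ : ℝ → ℝ, γ 1 = 18 * d ∧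
          ∀ α : ℝ, (d : ℝ) ≤ α → IsLIL (openSimplex d) logReg α γ) ∧
        (∀ (α η : ℝ), 0 < η → ∀ r y : Fin d → ℝ, (∀ k, 0 < y k) →
          (IsLiftedLogStep α η r y ↔
            IsStep (openSimplex d) logReg α η r (η * ∑ k, y k) (normalize y))) ∧
        ∀ α η : ℝ, 4 * (18 * d) + 1 ≤ α → 0 < η → η ≤ rateCap (18 * d) 1 L n →
          (∀ r, ∃ lam x, IsStep (openSimplex d) logReg α η r lam x) ∧
          (∀ T : ℕ, 1 ≤ T → SelfPlayRegretLE (openSimplex d) logReg n L α η T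
            (6 + 2 * (α * Real.log T + d * Real.log T) / η)) ∧
          (η = rateCap (18 * d) 1 L n → α = 4 * (18 * d) + 1 → ∀ T : ℕ, 2 ≤ T →
            SelfPlayRegretLE (openSimplex d) logReg n L α η T
              (C * max 1 (L * n) * d * Real.log T)) ∧
          AdaptiveIsCOFTRL (openSimplex d) logReg n L 1 α η (fun m => d * Real.log m) ∧
          (∀ T : ℕ, 1 ≤ T →
            AdversarialRegretLE (openSimplex d) logReg n L 1 α η (fun m => d * Real.log m) T
              (8 + 2 * (α * Real.log T + d * Real.log T) / η + 4 * √(T * Real.log d))) ∧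
          (∃ T₀ : ℕ, ∀ T : ℕ, T₀ ≤ T →
            AdversarialRegretLE (openSimplex d) logReg n L 1 α η (fun m => d * Real.log m) T
              (C * √(T * Real.log d)))) := by
  -- The most demanding case is the log regularizer, which needs `160 · 74 + 9`.
  refine ⟨20000, by norm_num, fun n d hn hd L hL => ⟨?_, ?_⟩⟩
  · intro ψ γ μ α η hψ hμ hsc hlil hα hη hcap
    have h := isAdmissible_of_real hn hd hL hψ hμ hsc hlil hα hη hcap
    have hγ := h.gamma_pos
    refine ⟨h.exists_isStep, fun T hT => h.selfPlayRegretLE hT, ?_, ?_, h.adaptiveIsCOFTRL,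
      fun T hT => h.adversarialRegretLE hT,
      h.exists_adversarial_horizon (a := regRange ψ) (b := 0) (fun T => by simp) (by norm_num)⟩
    · intro hcap' T hT
      refine (h.selfPlayRegretLE hT).mono ?_
      have h1 := le_rateCap_mul hγ hL hn hμ
      rw [← hcap'] at h1
      have h2 := h.bound_nonneg hT
      have hb : 0 ≤ α * Real.log T + regRange ψ := by
        have := mul_nonneg h2 hη.le
        rwa [div_mul_cancel₀ _ hη.ne'] at this
      have h3 : 2 * (α * Real.log T + regRange ψ) / η ≤ 2 * ((α * Real.log T + regRange ψ) / μ) *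
          max (max (80 * μ / (3 * γ 1)) (8 * μ)) (max (32 * √2) (L * n * 32 * √6)) := by
        rw [div_le_iff₀ hη]
        have h4 := mul_le_mul_of_nonneg_left h1
          (show 0 ≤ 2 * ((α * Real.log T + regRange ψ) / μ) by positivity)
        have e : 2 * ((α * Real.log T + regRange ψ) / μ) * μ =
          2 * (α * Real.log T + regRange ψ) := by field_simp
        linarith
      linarith
    · intro hcap' hα' hμ1 hμγ T hT
      have hT1 : 1 ≤ T := by omega
      have hlog := two_thirds_le_log hT
      have hR : 0 ≤ regRange ψ := h.range_nonneg hT1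
      have hm : 1 ≤ max 1 (L * n) := le_max_left _ _
      have hA : 0 ≤ α * Real.log T + regRange ψ := by
        have := h.alpha_pos
        positivity
      have h1 := bound_le_of_rateCap hL hn hμ1 hμγ hA hη hcap'
      set m := max 1 (L * n)
      have h2 : α * Real.log T ≤ 5 * (γ 1 * Real.log T) := by
        have := mul_le_mul_of_nonneg_right (show α ≤ 5 * γ 1 by linarith)
          (show 0 ≤ Real.log T by linarith)
        linarith
      have h3 : 2 / 3 ≤ γ 1 * Real.log T := by nlinarith
      have h4 : 6 + 2 * (α * Real.log T + regRange ψ) / η ≤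
          10000 * m * (γ 1 * Real.log T + regRange ψ) := by
        have a1 := mul_le_mul_of_nonneg_left h2 (show 0 ≤ 160 * m by linarith)
        have a2 : 6 ≤ 9 * (m * (γ 1 * Real.log T)) := by nlinarith
        have a3 : 0 ≤ m * regRange ψ := by positivity
        linarith
      have h5 : 0 ≤ m * (γ 1 * Real.log T + regRange ψ) := by positivity
      refine ⟨(h.selfPlayRegretLE hT1).mono (by linarith), fun hRle =>
        (h.selfPlayRegretLE hT1).mono ?_⟩
      have := mul_le_mul_of_nonneg_left hRle (show 0 ≤ 10000 * m by linarith)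
      linarith
  · refine ⟨isRegularizer_logReg, logReg_stronglyConvex,
      ⟨fun ε => 2 * d * (2 + ε) ^ 2, by ring, fun α hα => isLIL_logReg hα⟩,
      fun α η hη r y hy => isLiftedLogStep_iff hd hη r hy, ?_⟩
    intro α η hα hη hcap
    have h := isAdmissible_logReg hn hd hL hα hη hcap
    refine ⟨h.exists_isStep, fun T hT => h.selfPlayRegretLE hT, ?_, h.adaptiveIsCOFTRL,
      fun T hT => h.adversarialRegretLE hT,
      h.exists_adversarial_horizon (a := 0) (b := d) (fun T => by simp) (by norm_num)⟩
    intro hcap' hα' T hT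
    have hT1 : 1 ≤ T := by omega
    have hlog := two_thirds_le_log hT
    have hd1 : (1 : ℝ) ≤ d := by exact_mod_cast (by omega : 1 ≤ d)
    have hm : 1 ≤ max 1 (L * n) := le_max_left _ _
    have hA : 0 ≤ α * Real.log T + d * Real.log T := by
      have := h.alpha_pos
      positivity
    have h1 := bound_le_of_rateCap hL hn le_rfl (by linarith) hA hη hcap'
    refine (h.selfPlayRegretLE hT1).mono ?_
    set m := max 1 (L * n)
    have h2 : α * Real.log T + d * Real.log T ≤ 74 * (d * Real.log T) := by
      have := mul_le_mul_of_nonneg_right (show α + d ≤ 74 * d by linarith)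
        (show 0 ≤ Real.log T by linarith)
      linarith
    have h3 : 2 / 3 ≤ d * Real.log T := by nlinarith
    have a1 := mul_le_mul_of_nonneg_left h2 (show 0 ≤ 160 * m by linarith)
    have a2 : 6 ≤ 9 * (m * (d * Real.log T)) := by nlinarith
    linarith
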